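/- **Setting.** Let $F:\mathbb R^n\to\mathbb R$ be bounded below, $F^*=\inf_{\mathbb R^n}F$, and twice differentiable. Let $X\subseteq\mathbb R^n$ be convex (for instance $X=\mathbb R^n$) and suppose that for all $x,y\in X$ (with operator norms for matrices) $$\|\nabla F(x)-\nabla F(y)\|\le L_g\|x-y\|,\qquad \|\nabla^2F(x)-\nabla^2F(y)\|\le L_H\|x-y\|,$$ and that $F$ satisfies the weak gradient dominance condition with $\alpha=1$, i.e. for some $C_{\rm weak}>0$, $\epsilon_{\rm weak}\ge 0$, $$F(x)-F^*\le C_{\rm weak}\|\nabla F(x)\|+\epsilon_{\rm weak}\qquad(x\in X).$$ For a random $\xi\sim\mathcal D$ let $\nabla F(x,\xi)$ and $\nabla^2F(x,\xi)$ (a symmetric matrix) be stochastic gradients and Hessians, jointly measurable in $(x,\xi)$, which at every $x\in X$ are unbiased and satisfy $$\mathbb E\|\nabla F(x)-\nabla F(x,\xi)\|^2\le\sigma_g^2,\qquad \mathbb E\|\nabla^2F(x)-\nabla^2F(x,\xi)\|^2\le\sigma_h^2 .$$ **Algorithm (SHSODM).** Inputs: $K,n_g,n_H\ge1$, tolerances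 $\epsilon_{\rm ls},\epsilon_{\rm eig}>0$, ratio $C_e>0$, starting point $x_1$. For $k=1,\dots,K$: 1. Draw fresh samples (each batch i.i.d. and independent of $x_k$) and let $\hat g$ and $\hat H$ be the averages of $n_g$ stochastic gradients and of $n_H$ stochastic Hessians at $x_k$. 2. Let $p$ be the orthogonal projection of $\hat g$ onto the eigenspace $S_{\min}$ of the smallest eigenvalue of $\hat H$. If $\|p\|\ge\epsilon_{\rm eig}$, put $g'=\hat g$; otherwise put $g'=\hat g+\epsilon_{\rm eig}u$ with $u=p/\|p\|$ (any unit vector $u\in S_{\min}$ if $p=0$). 3. For $\delta\in\mathbb R$ let $A(\delta)=\begin{pmatrix}\hat H&g'\\ g'^{T}&-\delta\end{pmatrix}$, $\lambda(\delta)=-\lambda_{\min}(A(\delta))$, and $d(\delta)=v/t$, where $[v;t]$ is an eigenvector of $A(\delta)$ for its smallest eigenvalue. Start from any interval $[\delta_l,\delta_r]$ with $\delta_l\le-\frac{\|g'\|^2(\|\hat H\|+\sqrt{C_e\epsilon_{\rm eig}})}{C_e\epsilon_{\rm eig}}-\|\hat H\|$ and $\delta_r\ge C_e\|g'\|+\|\hat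 H\|+1$. Repeat: let $\delta_m$ be its midpoint; if $C_e\|d(\delta_m)\|\le\lambda(\delta_m)$ set $\delta_r\leftarrow\delta_m$, else set $\delta_l\leftarrow\delta_m$; stop as soon as $|\delta_r-\delta_l|<\epsilon_{\rm ls}$. 4. Set $x_{k+1}=x_k+d(\delta_m)$ with the last $\delta_m$. The output is $x_K$; the number of samples is $K(n_g+n_H)$. **Claim.** For all $n,L_g,L_H,\sigma_g,\sigma_h,C_{\rm weak},\Delta$ there are constants $C,C_e>0$, depending only on these numbers, such that for every $\epsilon\in(0,1]$ there are inputs $K,n_g,n_H,\epsilon_{\rm ls},\epsilon_{\rm eig}$ (with the ratio $C_e$), depending only on these numbers and $\epsilon$, with $\epsilon_{\rm ls},\epsilon_{\rm eig}\le C\epsilon$ and $$K(n_g+n_H)\le C\,\epsilon^{-2.5},$$ for which the following holds. For every $F$, $X$, $\epsilon_{\rm weak}$ and stochastic gradients and Hessians as above, every $x_1$ with $F(x_1)-F^*\le\Delta$, and every run of SHSODM from $x_1$ whose iterates $x_1,\dots,x_K$ almost surely lie in $X$ (no restriction if $X=\mathbb R^n$), $F(x_K)$ is integrable and $$\mathbb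 E\big[F(x_K)-F^*\big]<\epsilon+\epsilon_{\rm weak}.$$ -/

import Mathlib

open MeasureTheory ProbabilityTheory

universe u v

noncomputable section

/-- The Euclidean space `ℝⁿ`. -/
abbrev Euc (n : ℕ) : Type := EuclideanSpace ℝ (Fin n)

/-! ### The problem class -/

/-- The Hessian `∇²F(x)`, as a bounded operator (so that norms of Hessians are operator norms). -/
def hessian {n : ℕ} (F : Euc n → ℝ) (x : Euc n) : Euc n →L[ℝ] Euc n :=
  fderiv ℝ (gradient F) x

/-- `F` is twice differentiable, and on `X` its gradient and its Hessian are Lipschitz continuous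
with constants `Lg` and `LH`. -/
structure IsSmoothOn {n : ℕ} (F : Euc n → ℝ) (X : Set (Euc n)) (Lg LH : ℝ) : Prop where
  differentiable : Differentiable ℝ F
  differentiable_gradient : Differentiable ℝ (gradient F)
  lipschitz_gradient : ∀ x ∈ X, ∀ y ∈ X, ‖gradient F x - gradient F y‖ ≤ Lg * ‖x - y‖
  lipschitz_hessian : ∀ x ∈ X, ∀ y ∈ X, ‖hessian F x - hessian F y‖ ≤ LH * ‖x - y‖

/-- Weak gradient dominance on `X`: `F x - F* ≤ C ‖∇F x‖ ^ α + εw`, where `F* = inf F` is the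
infimum over the whole space. -/
def WeakGradientDominanceOn {n : ℕ} (F : Euc n → ℝ) (X : Set (Euc n)) (α C εw : ℝ) : Prop :=
  ∀ x ∈ X, F x - ⨅ y, F y ≤ C * ‖gradient F x‖ ^ α + εw

/-- `G x ξ` and `Hs x ξ`, with `ξ` drawn from `D`, are a stochastic gradient and a (symmetric)
stochastic Hessian of `F`: at every query point of `X` they are unbiased, and
`E ‖∇F x - G x ξ‖ ^ 2 ≤ σg ^ 2`, `E ‖∇²F x - Hs x ξ‖ ^ (2 α) ≤ σh ^ 2`. -/
structure IsStochasticOracleOn {n : ℕ} {Ξ : Type u} [MeasurableSpace Ξ] (D : Measure Ξ)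
    (F : Euc n → ℝ) (X : Set (Euc n)) (α σg σh : ℝ)
    (G : Euc n → Ξ → Euc n) (Hs : Euc n → Ξ → (Euc n →L[ℝ] Euc n)) : Prop where
  measurable_grad : Measurable (Function.uncurry G)
  measurable_hess : Measurable (Function.uncurry Hs)
  symmetric_hess : ∀ x ξ, IsSelfAdjoint (Hs x ξ)
  integrable_grad : ∀ x ∈ X, Integrable (G x) D
  integrable_hess : ∀ x ∈ X, Integrable (Hs x) D
  unbiased_grad : ∀ x ∈ X, ∫ ξ, G x ξ ∂D = gradient F x
  unbiased_hess : ∀ x ∈ X, ∫ ξ, Hs x ξ ∂D = hessian F x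
  integrable_var_grad : ∀ x ∈ X, Integrable (fun ξ => ‖gradient F x - G x ξ‖ ^ 2) D
  integrable_var_hess : ∀ x ∈ X,
    Integrable (fun ξ => ‖hessian F x - Hs x ξ‖ ^ (2 * α)) D
  variance_grad : ∀ x ∈ X, ∫ ξ, ‖gradient F x - G x ξ‖ ^ 2 ∂D ≤ σg ^ 2
  variance_hess : ∀ x ∈ X, ∫ ξ, ‖hessian F x - Hs x ξ‖ ^ (2 * α) ∂D ≤ σh ^ 2

/-! ### Leftmost eigenpairs and the homogenized matrix -/

/-- The smallest eigenvalue (all operators below are symmetric in finite dimension). -/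
def leftmostEigenvalue {V : Type*} [AddCommGroup V] [Module ℝ V] (A : Module.End ℝ V) : ℝ :=
  sInf {μ : ℝ | A.HasEigenvalue μ}

/-- An eigenvector for the smallest eigenvalue. -/
def leftmostEigenvector {V : Type*} [AddCommGroup V] [Module ℝ V] (A : Module.End ℝ V) : V :=
  Classical.epsilon fun z => A.HasEigenvector (leftmostEigenvalue A) z

/-- The eigenspace `S_min` of the smallest eigenvalue of `H`. -/
def minEigenspace {n : ℕ} (H : Euc n →L[ℝ] Euc n) : Submodule ℝ (Euc n) :=
  Module.End.eigenspace (H : Module.End ℝ (Euc n))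
    (leftmostEigenvalue (H : Module.End ℝ (Euc n)))

/-- The homogenized matrix `A(δ) = [H, g; gᵀ, -δ]`, acting on pairs `[v; t]`. -/
def homogenized {n : ℕ} (H : Euc n →L[ℝ] Euc n) (g : Euc n) (δ : ℝ) :
    Module.End ℝ (Euc n × ℝ) :=
  LinearMap.prod
    (LinearMap.coprod (H : Euc n →ₗ[ℝ] Euc n) (LinearMap.toSpanSingleton ℝ (Euc n) g))
    (LinearMap.coprod (innerₛₗ ℝ g) ((-δ) • LinearMap.id))

theorem homogenized_apply {n : ℕ} (H : Euc n →L[ℝ] Euc n) (g : Euc n) (δ : ℝ) (v : Euc n)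
    (t : ℝ) : homogenized H g δ (v, t) = (H v + t • g, inner ℝ g v + -δ * t) := by
  simp [homogenized]

/-- The dual variable `λ(δ) = -λ_min(A(δ))`. -/
def dualValue {n : ℕ} (H : Euc n →L[ℝ] Euc n) (g : Euc n) (δ : ℝ) : ℝ :=
  -leftmostEigenvalue (homogenized H g δ)

/-- The direction `d(δ) = v / t`, where `[v; t]` is a leftmost eigenvector of `A(δ)`. -/
def homDirection {n : ℕ} (H : Euc n →L[ℝ] Euc n) (g : Euc n) (δ : ℝ) : Euc n :=
  (leftmostEigenvector (homogenized H g δ)).2⁻¹ • (leftmostEigenvector (homogenized H g δ)).1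

/-! ### The algorithm -/

/-- `g'` is an output of the perturbation strategy for the inputs `H`, `g`, `εeig`: if the
projection `p` of `g` onto `S_min` has norm at least `εeig`, then `g' = g`; otherwise
`g' = g + εeig • u` with `u = p / ‖p‖`, or with any unit vector `u` of `S_min` when `p = 0`. -/
def IsPerturbation {n : ℕ} (H : Euc n →L[ℝ] Euc n) (g : Euc n) (εeig : ℝ) (g' : Euc n) : Prop :=
  (εeig ≤ ‖(minEigenspace H).starProjection g‖ ∧ g' = g) ∨
  (‖(minEigenspace H).starProjection g‖ < εeig ∧
    ∃ u ∈ minEigenspace H, ‖u‖ = 1 ∧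
      (minEigenspace H).starProjection g = ‖(minEigenspace H).starProjection g‖ • u ∧
      g' = g + εeig • u)

/-- The bisection of the line search with ratio `Ce` and tolerance `tol`, run on `[l, r]` for at
most `J` rounds; it returns the last midpoint.  The quantity `λ(δ) - Ce ‖d(δ)‖` increases with
`δ`, so the right end moves when it is nonnegative and the left end otherwise. -/
def bisect {n : ℕ} (H : Euc n →L[ℝ] Euc n) (g : Euc n) (Ce tol : ℝ) : ℕ → ℝ → ℝ → ℝ
  | 0, l, r => (l + r) / 2
  | J + 1, l, r =>
    open Classical in
    let m := (l + r) / 2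
    let l' := if Ce * ‖homDirection H g m‖ ≤ dualValue H g m then l else m
    let r' := if Ce * ‖homDirection H g m‖ ≤ dualValue H g m then m else r
    if |r' - l'| < tol then m else bisect H g Ce tol J l' r'

/-- A number of rounds, logarithmic in `(r - l) / tol`, after which the width of the search
interval is below `tol`. -/
def bisectRounds (tol l r : ℝ) : ℕ := Nat.clog 2 ⌈(r - l) / tol⌉₊ + 1

/-- A priori left end of the search interval. -/
def searchLeft {n : ℕ} (H : Euc n →L[ℝ] Euc n) (g : Euc n) (Ce εeig : ℝ) : ℝ :=
  -(‖g‖ ^ 2 * (‖H‖ + √(Ce * εeig)) / (Ce * εeig)) - ‖H‖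

/-- A priori right end of the search interval. -/
def searchRight {n : ℕ} (H : Euc n →L[ℝ] Euc n) (g : Euc n) (Ce : ℝ) : ℝ :=
  Ce * ‖g‖ + ‖H‖ + 1

/-- Inputs of SHSODM: number of iterations, the two sample sizes, the two tolerances, and the
ratio of the line search. -/
structure SHSODMParams where
  K : ℕ
  ng : ℕ
  nH : ℕ
  εls : ℝ
  εeig : ℝ
  Ce : ℝ

/-- One update of SHSODM from `x` to `x'` with gradient and Hessian estimates `g`, `H`: perturb
the gradient, run the line search from some initial interval `[l, r]` that contains the a priori
one, and move along the direction that it returns. -/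
def SHSODMStep {n : ℕ} (p : SHSODMParams) (g : Euc n) (H : Euc n →L[ℝ] Euc n)
    (x x' : Euc n) : Prop :=
  ∃ (g' : Euc n) (l r : ℝ), IsPerturbation H g p.εeig g' ∧
    l ≤ searchLeft H g' p.Ce p.εeig ∧ searchRight H g' p.Ce ≤ r ∧
    x' = x + homDirection H g' (bisect H g' p.Ce p.εls (bisectRounds p.εls l r) l r)

/-- The average of `N` vectors. -/
def batchMean {V : Type*} [AddCommGroup V] [Module ℝ V] {N : ℕ} (w : Fin N → V) : V :=
  (N : ℝ)⁻¹ • ∑ i, w i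

/-- `x 1, x 2, …` are the random iterates of a run of SHSODM from `x₁`, on the probability space
`(Ω, P)`, where `ξg k` and `ξH k` are the batches of `ng` and `nH` samples of iteration `k`.
Each batch is i.i.d. with law `D` and is drawn afresh, hence independently of the current
iterate `x k`. -/
structure IsSHSODMRun {n : ℕ} {Ξ : Type u} [MeasurableSpace Ξ] {Ω : Type v} [MeasurableSpace Ω]
    (P : Measure Ω) (D : Measure Ξ)
    (G : Euc n → Ξ → Euc n) (Hs : Euc n → Ξ → (Euc n →L[ℝ] Euc n))
    (p : SHSODMParams) (x₁ : Euc n)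
    (ξg : ℕ → Fin p.ng → Ω → Ξ) (ξH : ℕ → Fin p.nH → Ω → Ξ) (x : ℕ → Ω → Euc n) : Prop where
  measurable_iterate : ∀ k, Measurable (x k)
  law_g : ∀ k ∈ Finset.Icc 1 p.K, ∀ i, MeasurePreserving (ξg k i) P D
  law_H : ∀ k ∈ Finset.Icc 1 p.K, ∀ i, MeasurePreserving (ξH k i) P D
  indep_g : ∀ k ∈ Finset.Icc 1 p.K, iIndepFun (ξg k) P
  indep_H : ∀ k ∈ Finset.Icc 1 p.K, iIndepFun (ξH k) P
  fresh_g : ∀ k ∈ Finset.Icc 1 p.K, IndepFun (x k) (fun ω i => ξg k i ω) P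
  fresh_H : ∀ k ∈ Finset.Icc 1 p.K, IndepFun (x k) (fun ω i => ξH k i ω) P
  init : ∀ᵐ ω ∂P, x 1 ω = x₁
  step : ∀ k ∈ Finset.Icc 1 p.K, ∀ᵐ ω ∂P,
    SHSODMStep p (batchMean fun i => G (x k ω) (ξg k i ω))
      (batchMean fun i => Hs (x k ω) (ξH k i ω)) (x k ω) (x (k + 1) ω)

end

/-! ### Leftmost eigenpairs of symmetric operators -/

/-! One step is an inexact cubic-regularized Newton step. Scaling a leftmost eigenvector of `A(δ)`
so that `t = 1` gives `(H + λ) d = -g'` and `δ = λ + ⟪g', d⟫`, with `H + λ` positive semidefinite.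
The perturbation gives `g'` a component of size at least `εeig` in `S_min`, so that `t ≠ 0`, `H + λ`
is positive definite, and `λ` and `‖d‖` vary little over a `δ`-interval shorter than `εeig`
(`IsDualPair.compare`). Bisection therefore ends with `λ` between `Ce ‖d‖ / 2` and `2 Ce ‖d‖`, up to
`εls` (`lineSearch_spec`).

Let `e` and `q` be the gradient and Hessian errors, each enlarged by its tolerance. Taylor expansion
then shows that `F` drops by `‖d‖ ^ 3` up to multiples of `e ^ (3/2)` and `q ^ 3`, while the new
gradient is at most a multiple of `‖d‖ ^ 2`, plus `e + q ^ 2` (`IsSmoothOn.newton_step`). Gradient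
dominance turns the second bound into one on the new excess `h`, so the drop is of order `h ^
(3/2)`.

The obstacle is `q ^ 3`: only the second moment of the Hessian error is controlled.
`pos_part_recursion` removes it pathwise: for `y = (h - C q ^ 2)₊` and old excess `f`, `y + c y ^
(3/2) ≤ f + C e ^ (3/2)`, because `q ^ 3` is absorbed by the decrease whenever `y > 0`. Taking
expectations, with convexity of the power `3/2`, then needs second moments only
(`expected_recursion`).

With both root mean square errors at most `θ ε / 2` and `θ` small, the mean excess satisfies `a' +
(c/8) a' ^ (3/2) ≤ a` while `a' ≥ ε` (`noisy_decrease`). Then `1 / √a` grows by a fixed amount per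
step, so `O(ε ^ (-1/2))` steps suffice (`lt_of_cubic_decrease`). Batches of size `O(ε ^ (-2))`
achieve this accuracy, and the product is `O(ε ^ (-5/2))`. -/

theorem hasEigenvalue_iff_exists {V : Type*} [AddCommGroup V] [Module ℝ V] (A : Module.End ℝ V)
    (μ : ℝ) : A.HasEigenvalue μ ↔ ∃ z, z ≠ 0 ∧ A z = μ • z := by
  constructor
  · intro h
    obtain ⟨z, hz⟩ := h.exists_hasEigenvector
    exact ⟨z, hz.2, hz.apply_eq_smul⟩
  · rintro ⟨z, hz, h⟩
    exact Module.End.hasEigenvalue_of_hasEigenvector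
      (x := z) ⟨Module.End.mem_eigenspace_iff.2 h, hz⟩

theorem hasEigenvector_leftmostEigenvector {V : Type*} [AddCommGroup V] [Module ℝ V]
    {A : Module.End ℝ V} (h : A.HasEigenvalue (leftmostEigenvalue A)) :
    A.HasEigenvector (leftmostEigenvalue A) (leftmostEigenvector A) :=
  Classical.epsilon_spec (p := fun z => A.HasEigenvector (leftmostEigenvalue A) z)
    h.exists_hasEigenvector

/-- In finite dimension the infimum of the Rayleigh quotient is an eigenvalue, and it bounds every
other eigenvalue from below. -/
theorem leftmostEigenvalue_spec {E : Type*} [NormedAddCommGroup E] [InnerProductSpace ℝ E]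
    [FiniteDimensional ℝ E] [Nontrivial E] {T : Module.End ℝ E} (hT : LinearMap.IsSymmetric T) :
    T.HasEigenvalue (leftmostEigenvalue T) ∧
      ∀ v, leftmostEigenvalue T * ‖v‖ ^ 2 ≤ inner ℝ (T v) v := by
  have h1 := hT.hasEigenvalue_iInf_of_finiteDimensional
  set m : ℝ := ⨅ x : { x : E // x ≠ 0 }, RCLike.re (inner ℝ (T x) x) / ‖(x : E)‖ ^ 2 with hm
  have hbdd : BddBelow (Set.range fun x : { x : E // x ≠ 0 } =>
      RCLike.re (inner ℝ (T x) (x : E)) / ‖(x : E)‖ ^ 2) := by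
    refine ⟨-‖LinearMap.toContinuousLinearMap T‖, ?_⟩
    rintro _ ⟨x, rfl⟩
    have hx : 0 < ‖(x : E)‖ ^ 2 := by have := norm_pos_iff.2 x.2; positivity
    simp only [RCLike.re_to_real]
    rw [le_div_iff₀ hx]
    have h2 := abs_real_inner_le_norm (T x) (x : E)
    have h3 := (LinearMap.toContinuousLinearMap T).le_opNorm (x : E)
    simp only [LinearMap.coe_toContinuousLinearMap'] at h3
    have h4 := mul_le_mul_of_nonneg_right h3 (norm_nonneg (x : E))
    have := (abs_le.1 h2).1
    nlinarith
  have hray : ∀ v, m * ‖v‖ ^ 2 ≤ inner ℝ (T v) v := by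
    intro v
    by_cases hv : v = 0
    · simp [hv]
    · have h2 : m ≤ _ := ciInf_le hbdd ⟨v, hv⟩
      have hx : 0 < ‖v‖ ^ 2 := by have := norm_pos_iff.2 hv; positivity
      simpa [le_div_iff₀ hx] using h2
  have heq : leftmostEigenvalue T = m := by
    refine IsLeast.csInf_eq ⟨h1, ?_⟩
    intro μ hμ
    obtain ⟨z, hz, hzz⟩ := (hasEigenvalue_iff_exists T μ).1 hμ
    have h2 := hray z
    rw [hzz, real_inner_smul_left, real_inner_self_eq_norm_sq] at h2
    have hx : 0 < ‖z‖ ^ 2 := by have := norm_pos_iff.2 hz; positivity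
    exact le_of_mul_le_mul_right h2 hx
  rw [heq]
  exact ⟨h1, hray⟩

/-- Needed because `Euc n × ℝ` carries the sup norm: the spectral theorem is applied on `WithLp 2`
and transported back. -/
theorem leftmostEigenvalue_conj {V W : Type*} [AddCommGroup V] [Module ℝ V] [AddCommGroup W]
    [Module ℝ W] (e : V ≃ₗ[ℝ] W) (A : Module.End ℝ V) :
    leftmostEigenvalue (e.conj A) = leftmostEigenvalue A := by
  unfold leftmostEigenvalue
  congr 1
  ext μ
  simp only [Set.mem_ofPred_eq, hasEigenvalue_iff_exists]
  constructor
  · rintro ⟨z, hz, h⟩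
    refine ⟨e.symm z, by simpa using hz, ?_⟩
    apply e.injective
    simpa [LinearEquiv.conj_apply_apply] using h
  · rintro ⟨z, hz, h⟩
    refine ⟨e z, by simpa using hz, ?_⟩
    simp [LinearEquiv.conj_apply_apply, h]

theorem homogenized_spec {n : ℕ} {H : Euc n →L[ℝ] Euc n} (hH : IsSelfAdjoint H) (g : Euc n)
    (δ : ℝ) :
    (homogenized H g δ).HasEigenvalue (leftmostEigenvalue (homogenized H g δ)) ∧
      ∀ v t, 0 ≤ inner ℝ (H v) v + 2 * t * inner ℝ g v - δ * t ^ 2 +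
        dualValue H g δ * (‖v‖ ^ 2 + t ^ 2) := by
  let e := (WithLp.linearEquiv 2 ℝ (Euc n × ℝ)).symm
  have hsymH : ∀ v w, inner ℝ (H v) w = inner ℝ v (H w) := fun v w =>
    (ContinuousLinearMap.isSelfAdjoint_iff_isSymmetric.1 hH) v w
  have key : ∀ (a b : WithLp 2 (Euc n × ℝ)),
      inner ℝ ((e.conj (homogenized H g δ)) a) b =
        inner ℝ (H a.fst) b.fst + a.snd * inner ℝ g b.fst +
          (inner ℝ g a.fst - δ * a.snd) * b.snd := by
    intro a b
    rw [WithLp.prod_inner_apply]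
    have : (e.conj (homogenized H g δ)) a =
        WithLp.toLp 2 (homogenized H g δ (a.fst, a.snd)) := rfl
    rw [this, homogenized_apply]
    simp [inner_add_left, real_inner_smul_left]
    ring
  have hsym : LinearMap.IsSymmetric (e.conj (homogenized H g δ)) := by
    intro a b
    rw [key, real_inner_comm _ a, key, hsymH, real_inner_comm]
    ring
  obtain ⟨h1, h2⟩ := leftmostEigenvalue_spec hsym
  rw [leftmostEigenvalue_conj] at h1 h2
  constructor
  · rw [hasEigenvalue_iff_exists] at h1 ⊢
    obtain ⟨z, hz, h⟩ := h1
    refine ⟨e.symm z, by simpa using hz, ?_⟩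
    apply e.injective
    simpa [LinearEquiv.conj_apply_apply] using h
  · intro v t
    have h3 := h2 (WithLp.toLp 2 (v, t))
    rw [key, WithLp.prod_norm_sq_eq_of_L2] at h3
    simp only [dualValue]
    simp at h3
    nlinarith

/-! ### The dual value and the direction -/

/-- `(lam, d)` solves the optimality conditions of the homogenized problem at `δ`, where the
operator is bounded below by `μ`. -/
structure IsDualPair {n : ℕ} (H : Euc n →L[ℝ] Euc n) (g : Euc n) (μ δ lam : ℝ) (d : Euc n) :
    Prop where
  eq : H d + lam • d = -g
  secular : δ = lam + inner ℝ g d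
  pos : 0 < lam + μ

/-- `μ` is the least eigenvalue of the symmetric operator `H`, with a unit eigenvector `w` along
which `g` has a component of size at least `η`. -/
structure HasLeastDirection {n : ℕ} (H : Euc n →L[ℝ] Euc n) (g : Euc n) (η μ : ℝ) (w : Euc n) :
    Prop where
  symm : ∀ v z, inner ℝ (H v) z = inner ℝ v (H z)
  lower : ∀ v, μ * ‖v‖ ^ 2 ≤ inner ℝ (H v) v
  eigen : H w = μ • w
  unit : ‖w‖ = 1
  comp : η ≤ inner ℝ g w

/-- The direction is `p / ‖p‖` when the projection `p` is already large, where the component is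
`‖p‖`; otherwise it is `u`, where the component is `‖p‖ + η` since `p` is a nonnegative multiple of
`u`. -/
theorem IsPerturbation.hasLeastDirection {n : ℕ} {H : Euc n →L[ℝ] Euc n} (hH : IsSelfAdjoint H)
    {g g' : Euc n} {η : ℝ} (hη : 0 < η) (h : IsPerturbation H g η g') :
    ∃ w, HasLeastDirection H g' η (leftmostEigenvalue (H : Module.End ℝ (Euc n))) w := by
  have hsym : LinearMap.IsSymmetric (H : Module.End ℝ (Euc n)) :=
    ContinuousLinearMap.isSelfAdjoint_iff_isSymmetric.1 hH
  have main : ∀ w ∈ minEigenspace H, ‖w‖ = 1 → η ≤ inner ℝ g' w →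
      HasLeastDirection H g' η (leftmostEigenvalue (H : Module.End ℝ (Euc n))) w := by
    intro w hw hw1 hc
    have hw0 : w ≠ 0 := by rintro rfl; simp at hw1
    have : Nontrivial (Euc n) := ⟨w, 0, hw0⟩
    exact ⟨hsym, (leftmostEigenvalue_spec hsym).2, Module.End.mem_eigenspace_iff.1 hw, hw1, hc⟩
  have hP : ∀ w ∈ minEigenspace H,
      inner ℝ g w = inner ℝ ((minEigenspace H).starProjection g) w := by
    intro w hw
    have := Submodule.starProjection_inner_eq_zero (K := minEigenspace H) g w hw
    rw [inner_sub_left] at this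
    linarith
  rcases h with ⟨h1, rfl⟩ | ⟨-, u, hu, hu1, hp, rfl⟩
  · set p := (minEigenspace H).starProjection g' with hp
    have hp0 : 0 < ‖p‖ := hη.trans_le h1
    have hpm : p ∈ minEigenspace H := Submodule.starProjection_apply_mem _ _
    refine ⟨‖p‖⁻¹ • p, main _ (Submodule.smul_mem _ _ hpm) ?_ ?_⟩
    · rw [norm_smul, norm_inv, norm_norm, inv_mul_cancel₀ hp0.ne']
    · rw [inner_smul_right, hP p hpm, real_inner_self_eq_norm_sq]
      field_simp
      exact h1
  · refine ⟨u, main u hu hu1 ?_⟩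
    rw [inner_add_left, hP u hu, hp, real_inner_smul_left, real_inner_smul_left,
      real_inner_self_eq_norm_sq, hu1]
    have := norm_nonneg ((minEigenspace H).starProjection g)
    linarith

section
variable {n : ℕ} {H : Euc n →L[ℝ] Euc n} {g w : Euc n} {η μ : ℝ}

theorem HasLeastDirection.coercive (hw : HasLeastDirection H g η μ w) (lam : ℝ) (v : Euc n) :
    (lam + μ) * ‖v‖ ^ 2 ≤ inner ℝ (H v + lam • v) v := by
  rw [inner_add_left, real_inner_smul_left, real_inner_self_eq_norm_sq]
  linarith [hw.lower v]

theorem HasLeastDirection.norm_le (hw : HasLeastDirection H g η μ w) (lam : ℝ) (v : Euc n) :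
    (lam + μ) * ‖v‖ ≤ ‖H v + lam • v‖ := by
  rcases eq_or_ne v 0 with rfl | hv
  · simp
  have h1 := (hw.coercive lam v).trans (real_inner_le_norm _ _)
  have hv := norm_pos_iff.2 hv
  refine le_of_mul_le_mul_right ?_ hv
  linarith

theorem HasLeastDirection.isDualPair (hη : 0 < η) (hw : HasLeastDirection H g η μ w)
    (hH : IsSelfAdjoint H) (δ : ℝ) :
    IsDualPair H g μ δ (dualValue H g δ) (homDirection H g δ) := by
  obtain ⟨h1, h2⟩ := homogenized_spec hH g δ
  have h3 := hasEigenvector_leftmostEigenvector h1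
  have hpos : 0 < dualValue H g δ + μ := by
    by_contra! hneg
    have hc : 0 < inner ℝ g w := hη.trans_le hw.comp
    set a : ℝ := inner ℝ g w
    -- If `lam + μ ≤ 0`, the quadratic part is nonpositive along `w`, and this multiple of `w` makes
    -- the linear term `-(|lam - δ| + 1)`, which outweighs `lam - δ`.
    have h4 := h2 (-((|dualValue H g δ - δ| + 1) / (2 * a)) • w) 1
    simp only [map_smul, hw.eigen, real_inner_smul_left, inner_smul_right,
      real_inner_self_eq_norm_sq, norm_smul, hw.unit, Real.norm_eq_abs, mul_pow, sq_abs] at h4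
    have h5 : -((|dualValue H g δ - δ| + 1) / (2 * a)) * a = -(|dualValue H g δ - δ| + 1) / 2 := by
      field_simp
    change 0 ≤ _ + 2 * 1 * (_ * a) - _ + _ at h4
    rw [h5] at h4
    have h6 := le_abs_self (dualValue H g δ - δ)
    nlinarith [sq_nonneg ((|dualValue H g δ - δ| + 1) / (2 * a))]
  set z := leftmostEigenvector (homogenized H g δ) with hz
  have hd : homDirection H g δ = z.2⁻¹ • z.1 := rfl
  have h4 : homogenized H g δ (z.1, z.2) = leftmostEigenvalue (homogenized H g δ) • z :=
    h3.apply_eq_smul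
  rw [homogenized_apply, ← neg_neg (leftmostEigenvalue (homogenized H g δ))] at h4
  have h5 : H z.1 + z.2 • g = -(dualValue H g δ) • z.1 := congrArg Prod.fst h4
  have h6 : inner ℝ g z.1 + -δ * z.2 = -(dualValue H g δ) * z.2 := congrArg Prod.snd h4
  -- With `t = 0` the vector part would be in the kernel of `H + lam`, which is trivial because `lam
  -- + μ > 0`.
  have ht : z.2 ≠ 0 := by
    intro h0
    have h7 := hw.norm_le (dualValue H g δ) z.1
    have h8 : H z.1 + dualValue H g δ • z.1 = 0 := by
      rw [h0, zero_smul, add_zero] at h5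
      rw [h5]; module
    rw [h8, norm_zero] at h7
    have h9 : z.1 = 0 := by
      by_contra hne
      have := mul_pos hpos (norm_pos_iff.2 hne)
      linarith
    exact h3.2 (Prod.ext h9 h0)
  refine ⟨?_, ?_, hpos⟩
  · rw [hd, map_smul, eq_sub_of_add_eq h5, smul_comm (dualValue H g δ), ← smul_add]
    have : -dualValue H g δ • z.1 - z.2 • g + dualValue H g δ • z.1 = -(z.2 • g) := by module
    rw [this, smul_neg, smul_smul, inv_mul_cancel₀ ht, one_smul]
  · rw [hd, inner_smul_right, show inner ℝ g z.1 = (δ - dualValue H g δ) * z.2 by linarith]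
    field_simp
    ring

/-- Pairing `(H + lam) d = -g` with the eigenvector `w` leaves `(lam + μ) ⟪d, w⟫ = -⟪g, w⟫`. -/
theorem IsDualPair.le_norm {δ lam : ℝ} {d : Euc n} (hw : HasLeastDirection H g η μ w)
    (h : IsDualPair H g μ δ lam d) : η ≤ (lam + μ) * ‖d‖ := by
  have h1 : inner ℝ g w = -((lam + μ) * inner ℝ d w) := by
    rw [show g = -(H d + lam • d) by rw [h.eq, neg_neg], inner_neg_left, inner_add_left,
      hw.symm, hw.eigen, real_inner_smul_left, inner_smul_right]
    ring
  have h2 : |inner ℝ d w| ≤ ‖d‖ * ‖w‖ := abs_real_inner_le_norm d w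
  rw [hw.unit, mul_one] at h2
  have h3 := mul_le_mul_of_nonneg_left (abs_le.1 h2).1 h.pos.le
  linarith [hw.comp]

theorem IsDualPair.norm_le {δ lam : ℝ} {d : Euc n} (hw : HasLeastDirection H g η μ w)
    (h : IsDualPair H g μ δ lam d) : (lam + μ) * ‖d‖ ≤ ‖g‖ := by
  have := hw.norm_le lam d
  rwa [h.eq, norm_neg] at this

theorem HasLeastDirection.abs_le (hw : HasLeastDirection H g η μ w) : |μ| ≤ ‖H‖ := by
  have := H.le_opNorm w
  rwa [hw.eigen, norm_smul, hw.unit, mul_one, mul_one] at this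

/-- Two dual pairs at comparable `δ` have comparable dual values and directions. -/
theorem IsDualPair.compare {δl δr ll lr : ℝ} {dl dr : Euc n} (hη : 0 < η)
    (hw : HasLeastDirection H g η μ w)
    (hl : IsDualPair H g μ δl ll dl) (hr : IsDualPair H g μ δr lr dr)
    (hlt : δl < δr) (hclose : δr - δl ≤ η) :
    ll < lr ∧ lr - ll ≤ δr - δl ∧ ‖dr‖ ≤ ‖dl‖ ∧ ‖dl‖ ≤ 2 * ‖dr‖ := by
  -- Subtract the secular equations and express `⟪g, dr⟫` through `dl` and `⟪g, dl⟫` through `dr`;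
  -- the terms in `H` cancel by symmetry.
  have e1 : δr - δl = (lr - ll) * (1 + inner ℝ dl dr) := by
    have a1 : inner ℝ g dr = -(inner ℝ (H dl) dr + ll * inner ℝ dl dr) := by
      rw [show g = -(H dl + ll • dl) by rw [hl.eq, neg_neg], inner_neg_left, inner_add_left,
        real_inner_smul_left]
    have a2 : inner ℝ g dl = -(inner ℝ (H dl) dr + lr * inner ℝ dl dr) := by
      rw [show g = -(H dr + lr • dr) by rw [hr.eq, neg_neg], inner_neg_left, inner_add_left,
        real_inner_smul_left, real_inner_comm, ← hw.symm dl dr, real_inner_comm dl dr]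
    have := hl.secular
    have := hr.secular
    linarith
  have e2 : H (dl - dr) + ll • (dl - dr) = (lr - ll) • dr := by
    have := hl.eq.trans hr.eq.symm
    rw [map_sub, show H dl = H dr + lr • dr - ll • dl by rw [← this]; module]
    module
  have e3 : H (dl - dr) + lr • (dl - dr) = (lr - ll) • dl := by
    have := hl.eq.trans hr.eq.symm
    rw [map_sub, show H dl = H dr + lr • dr - ll • dl by rw [← this]; module]
    module
  have c2 := hw.coercive ll (dl - dr)
  have c3 := hw.coercive lr (dl - dr)
  rw [e2, real_inner_smul_left, inner_sub_right, real_inner_self_eq_norm_sq,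
    real_inner_comm] at c2
  rw [e3, real_inner_smul_left, inner_sub_right, real_inner_self_eq_norm_sq] at c3
  have p2 : 0 ≤ (ll + μ) * ‖dl - dr‖ ^ 2 := mul_nonneg hl.pos.le (sq_nonneg _)
  have p3 : 0 ≤ (lr + μ) * ‖dl - dr‖ ^ 2 := mul_nonneg hr.pos.le (sq_nonneg _)
  set i : ℝ := inner ℝ dl dr with hi
  have hlam : ll < lr := by
    by_contra! hle
    have hi0 : i < -1 := by
      by_contra! hi0
      nlinarith
    nlinarith [sq_nonneg ‖dl‖]
  have hi1 : ‖dr‖ ^ 2 ≤ i := by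
    by_contra! hlt
    nlinarith
  have hdr : ‖dr‖ ≤ ‖dl‖ := by
    have h1 : i ≤ ‖dl‖ * ‖dr‖ := real_inner_le_norm _ _
    by_contra! hlt
    nlinarith [norm_nonneg dl, norm_nonneg dr]
  refine ⟨hlam, by nlinarith [sq_nonneg ‖dr‖], hdr, ?_⟩
  have h1 := hw.norm_le lr (dl - dr)
  rw [e3, norm_smul, Real.norm_eq_abs, abs_of_pos (sub_pos.2 hlam)] at h1
  have h2 := hr.le_norm hw
  have h3 : ‖dl‖ - ‖dr‖ ≤ ‖dl - dr‖ := norm_sub_norm_le _ _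
  have h4 : η * ‖dl - dr‖ ≤ (lr - ll) * ‖dl‖ * ‖dr‖ :=
    calc η * ‖dl - dr‖ ≤ (lr + μ) * ‖dr‖ * ‖dl - dr‖ := by gcongr
      _ = (lr + μ) * ‖dl - dr‖ * ‖dr‖ := by ring
      _ ≤ _ := by gcongr
  -- Here `2 ‖dr‖ ≤ 1 + ‖dr‖ ^ 2 ≤ 1 + i`, so `e1` and `δr - δl ≤ η` apply. With `h4` this gives
  -- `‖dl - dr‖ ≤ ‖dl‖ / 2`.
  have h5 : (lr - ll) * ‖dr‖ ≤ η / 2 := by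
    have : (lr - ll) * (2 * ‖dr‖) ≤ (lr - ll) * (1 + i) := by
      refine mul_le_mul_of_nonneg_left ?_ (sub_pos.2 hlam).le
      nlinarith [sq_nonneg (‖dr‖ - 1)]
    linarith
  have h6 : η * ‖dl - dr‖ ≤ η * (‖dl‖ / 2) := by
    have := mul_le_mul_of_nonneg_right h5 (norm_nonneg dl)
    linarith
  have h7 := le_of_mul_le_mul_left h6 hη
  linarith

/-! ### The line search -/

/-- Testing the quadratic form at `[0; 1]` gives `λ(r) ≥ r`; hence `λ + μ ≥ 1`, so `‖d‖ ≤ ‖g‖`, and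
`r ≥ Ce ‖g‖`. -/
theorem searchRight_spec {Ce r : ℝ} (hCe : 0 < Ce) (hη : 0 < η) (hw : HasLeastDirection H g η μ w)
    (hH : IsSelfAdjoint H) (hr : searchRight H g Ce ≤ r) :
    Ce * ‖homDirection H g r‖ ≤ dualValue H g r := by
  have hp := hw.isDualPair hη hH r
  have h1 := (homogenized_spec hH g r).2 0 1
  simp only [map_zero, inner_zero_right, norm_zero] at h1
  have h2 := hp.norm_le hw
  have h3 := (abs_le.1 hw.abs_le).1
  unfold searchRight at hr
  have h4 : 1 ≤ dualValue H g r + μ := by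
    nlinarith [mul_nonneg hCe.le (norm_nonneg g)]
  have h5 : ‖homDirection H g r‖ ≤ ‖g‖ := by
    nlinarith [norm_nonneg (homDirection H g r)]
  nlinarith [norm_nonneg H]

/-- The secular equation gives `λ ≤ l + ‖g‖ ‖d‖`, and `(λ + μ) ‖d‖ ≤ ‖g‖`. A first contradiction
yields `λ ≤ ‖H‖ + a` with `a = √(Ce η)`. If `λ > Ce ‖d‖`, then `λ (λ + μ) ≥ Ce η`, which bounds `‖g‖
‖d‖` and forces `λ ≤ 0`. -/
theorem searchLeft_spec {Ce l : ℝ} (hCe : 0 < Ce) (hη : 0 < η) (hw : HasLeastDirection H g η μ w)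
    (hH : IsSelfAdjoint H) (hl : l ≤ searchLeft H g Ce η) :
    dualValue H g l ≤ Ce * ‖homDirection H g l‖ := by
  have hp := hw.isDualPair hη hH l
  have h2 := hp.norm_le hw
  have h3 := hp.le_norm hw
  have h4 := (abs_le.1 hw.abs_le).1
  have hs := hp.secular
  have hpos := hp.pos
  set lam := dualValue H g l
  set d := homDirection H g l
  set ρ := lam + μ with hρ
  have h5 : -(‖g‖ * ‖d‖) ≤ inner ℝ g d := (abs_le.1 (abs_real_inner_le_norm g d)).1
  set a := √(Ce * η) with ha
  have ha0 : 0 < a := Real.sqrt_pos.2 (by positivity)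
  have ha2 : Ce * η = a ^ 2 := (Real.sq_sqrt (by positivity)).symm
  unfold searchLeft at hl
  rw [← ha, ha2] at hl
  have hdiv : ‖g‖ ^ 2 * (‖H‖ + a) / a ^ 2 = ‖g‖ ^ 2 / a + ‖g‖ ^ 2 * ‖H‖ / a ^ 2 := by
    field_simp; ring
  have hg2 : ‖g‖ * ‖d‖ * ρ ≤ ‖g‖ ^ 2 := by nlinarith [norm_nonneg g]
  have hupper : lam ≤ ‖H‖ + a := by
    by_contra! hgt
    have h6 : a ≤ ρ := by linarith
    have h7 : ‖g‖ * ‖d‖ ≤ ‖g‖ ^ 2 / a := by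
      rw [le_div_iff₀ ha0]
      nlinarith [mul_nonneg (norm_nonneg g) (norm_nonneg d)]
    have h8 : 0 ≤ ‖g‖ ^ 2 * ‖H‖ / a ^ 2 := by positivity
    have := norm_nonneg H
    linarith
  by_contra! hgt
  have hlam : 0 < lam := lt_of_le_of_lt (by positivity) hgt
  have h6 : a ^ 2 ≤ lam * ρ := by
    rw [← ha2]
    nlinarith
  have h7 : ‖g‖ * ‖d‖ ≤ ‖g‖ ^ 2 * lam / a ^ 2 := by
    rw [le_div_iff₀ (by positivity)]
    have := mul_nonneg (norm_nonneg g) (norm_nonneg d)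
    nlinarith
  have h8 : ‖g‖ ^ 2 * lam / a ^ 2 ≤ ‖g‖ ^ 2 * (‖H‖ + a) / a ^ 2 := by gcongr
  have := norm_nonneg H
  linarith

/-- Only the opposite signs of `λ - Ce ‖d‖` at the two ends are kept as an invariant. The last
midpoint has just replaced an end, so it is one of the ends of the final interval. Under `hJ` the
width test succeeds before the rounds run out. -/
theorem bisect_spec {Ce tol : ℝ} (htol : 0 < tol) (J : ℕ) (l r : ℝ) (hlr : l < r)
    (hl : dualValue H g l ≤ Ce * ‖homDirection H g l‖)
    (hr : Ce * ‖homDirection H g r‖ ≤ dualValue H g r)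
    (hJ : r - l < tol * 2 ^ (J + 1)) :
    ∃ l' r', l' < r' ∧ r' - l' < tol ∧
      dualValue H g l' ≤ Ce * ‖homDirection H g l'‖ ∧
      Ce * ‖homDirection H g r'‖ ≤ dualValue H g r' ∧
      (bisect H g Ce tol (J + 1) l r = l' ∨ bisect H g Ce tol (J + 1) l r = r') := by
  induction J generalizing l r with
  | zero =>
    unfold bisect
    have h0 : r - l < tol * 2 := by simpa using hJ
    by_cases hm : Ce * ‖homDirection H g ((l + r) / 2)‖ ≤ dualValue H g ((l + r) / 2)
    · have hlt : |(l + r) / 2 - l| < tol := by rw [abs_lt]; constructor <;> linarith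
      simp only [hm, if_true, hlt]
      exact ⟨l, (l + r) / 2, by linarith, by linarith, hl, hm, Or.inr rfl⟩
    · have hlt : |r - (l + r) / 2| < tol := by rw [abs_lt]; constructor <;> linarith
      simp only [hm, if_false, hlt, if_true]
      exact ⟨(l + r) / 2, r, by linarith, by linarith, (not_le.1 hm).le, hr, Or.inl rfl⟩
  | succ J ih =>
    unfold bisect
    have h0 : r - l < 2 * (tol * 2 ^ (J + 1)) := by
      calc r - l < _ := hJ
        _ = _ := by ring
    by_cases hm : Ce * ‖homDirection H g ((l + r) / 2)‖ ≤ dualValue H g ((l + r) / 2)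
    · simp only [hm, if_true]
      split_ifs with hlt
      · exact ⟨l, (l + r) / 2, by linarith, (le_abs_self _).trans_lt hlt, hl, hm, Or.inr rfl⟩
      · exact ih l ((l + r) / 2) (by linarith) hl hm (by linarith)
    · simp only [hm, if_false]
      split_ifs with hlt
      · exact ⟨(l + r) / 2, r, by linarith, (le_abs_self _).trans_lt hlt, (not_le.1 hm).le, hr,
          Or.inl rfl⟩
      · exact ih ((l + r) / 2) r (by linarith) (not_le.1 hm).le hr (by linarith)

/-- The extra round in `bisectRounds` doubles the bound, which makes it strict. -/
theorem lt_mul_two_pow_bisectRounds {tol l r : ℝ} (htol : 0 < tol) :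
    r - l < tol * 2 ^ bisectRounds tol l r := by
  have h1 : ((⌈(r - l) / tol⌉₊ : ℕ) : ℝ) ≤ 2 ^ Nat.clog 2 ⌈(r - l) / tol⌉₊ := by
    exact_mod_cast Nat.le_pow_clog one_lt_two _
  have h2 := (Nat.le_ceil ((r - l) / tol)).trans h1
  rw [div_le_iff₀ htol] at h2
  have h3 : (0 : ℝ) < 2 ^ Nat.clog 2 ⌈(r - l) / tol⌉₊ := by positivity
  unfold bisectRounds
  rw [pow_succ]
  nlinarith

/-- The direction found by the line search, with its dual value `lam`, solves the regularized
Newton equation with `lam` comparable to `Ce ‖d‖`. -/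
theorem lineSearch_spec {Ce tol l r : ℝ} (hCe : 0 < Ce) (hη : 0 < η) (htol : 0 < tol)
    (htolη : tol ≤ η) (hw : HasLeastDirection H g η μ w) (hH : IsSelfAdjoint H)
    (hl : l ≤ searchLeft H g Ce η) (hr : searchRight H g Ce ≤ r) {d : Euc n}
    (hd : d = homDirection H g (bisect H g Ce tol (bisectRounds tol l r) l r)) :
    ∃ lam, H d + lam • d = -g ∧ 0 ≤ inner ℝ (H d + lam • d) d ∧
      Ce / 2 * ‖d‖ - tol ≤ lam ∧ lam ≤ 2 * Ce * ‖d‖ + tol := by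
  have hlr : l < r := by
    have h1 : searchLeft H g Ce η ≤ 0 := by
      unfold searchLeft
      have : 0 ≤ ‖g‖ ^ 2 * (‖H‖ + √(Ce * η)) / (Ce * η) := by positivity
      linarith [norm_nonneg H]
    have h2 : 1 ≤ searchRight H g Ce := by
      unfold searchRight
      have : 0 ≤ Ce * ‖g‖ := by positivity
      linarith [norm_nonneg H]
    linarith
  obtain ⟨l', r', hlt, hclose, hl', hr', hm⟩ := bisect_spec htol _ l r hlr
    (searchLeft_spec hCe hη hw hH hl) (searchRight_spec hCe hη hw hH hr)
    (lt_mul_two_pow_bisectRounds (l := l) (r := r) htol)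
  have pl := hw.isDualPair hη hH l'
  have pr := hw.isDualPair hη hH r'
  obtain ⟨c1, c2, c3, c4⟩ := pl.compare hη hw pr hlt (by linarith)
  have c3' := mul_le_mul_of_nonneg_left c3 hCe.le
  have c4' := mul_le_mul_of_nonneg_left c4 hCe.le
  have hnn : ∀ δ, 0 ≤ inner ℝ
      (H (homDirection H g δ) + dualValue H g δ • homDirection H g δ) (homDirection H g δ) := by
    intro δ
    have p := hw.isDualPair hη hH δ
    exact (mul_nonneg p.pos.le (sq_nonneg _)).trans (hw.coercive _ _)
  have hnr := mul_nonneg hCe.le (norm_nonneg (homDirection H g r'))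
  -- At either end one of the two bounds is the sign condition there; the other comes from the
  -- opposite end, at the cost of `tol` for `λ` and a factor `2` for `‖d‖`.
  rcases hm with hm | hm
  · rw [show bisectRounds tol l r = _ + 1 from rfl, hm] at hd
    subst hd
    exact ⟨dualValue H g l', pl.eq, hnn l', by linarith, by linarith⟩
  · rw [show bisectRounds tol l r = _ + 1 from rfl, hm] at hd
    subst hd
    exact ⟨dualValue H g r', pr.eq, hnn r', by linarith, by linarith⟩

end

/-! ### Second-order Taylor estimates -/

section
variable {n : ℕ} {F : Euc n → ℝ} {X : Set (Euc n)} {Lg LH : ℝ}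

theorem IsSmoothOn.gradient_taylor (hF : IsSmoothOn F X Lg LH) (hLH : 0 ≤ LH)
    (hX : Convex ℝ X) {x y : Euc n} (hx : x ∈ X) (hy : y ∈ X) :
    ‖gradient F y - gradient F x - hessian F x (y - x)‖ ≤ LH * ‖y - x‖ ^ 2 := by
  have h := (convex_segment x y).norm_image_sub_le_of_norm_hasFDerivWithin_le
    (f := fun z => gradient F z - hessian F x z) (f' := fun z => hessian F z - hessian F x)
    (C := LH * ‖y - x‖) (x := x) (y := y) ?_ ?_ (left_mem_segment ℝ x y)
    (right_mem_segment ℝ x y)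
  · rw [map_sub]
    refine (le_of_eq ?_).trans (h.trans_eq (by ring))
    congr 1
    abel
  · intro z _
    exact ((hF.differentiable_gradient z).hasFDerivAt.sub
      (hessian F x).hasFDerivAt).hasFDerivWithinAt
  · intro z hz
    refine (hF.lipschitz_hessian z (hX.segment_subset hx hy hz) x hx).trans ?_
    gcongr
    obtain ⟨t, ht, rfl⟩ := (segment_eq_image' ℝ x y ▸ hz :)
    simp only [add_sub_cancel_left, norm_smul, Real.norm_eq_abs, abs_of_nonneg ht.1]
    exact mul_le_of_le_one_left (norm_nonneg _) ht.2

theorem IsSmoothOn.taylor_le (hF : IsSmoothOn F X Lg LH) (hLH : 0 ≤ LH)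
    (hX : Convex ℝ X) {x d : Euc n} (hx : x ∈ X) (hy : x + d ∈ X) :
    F (x + d) ≤ F x + inner ℝ (gradient F x) d + inner ℝ (hessian F x d) d / 2 +
      LH * ‖d‖ ^ 3 := by
  have hseg : ∀ t ∈ Set.Icc (0 : ℝ) 1, x + t • d ∈ X := by
    intro t ht
    have := hX.add_smul_sub_mem hx hy ht
    simpa using this
  have hder : ∀ t : ℝ, HasDerivAt
      (fun s : ℝ => F (x + s • d) - s * inner ℝ (gradient F x) d -
        s ^ 2 / 2 * inner ℝ (hessian F x d) d)
      (inner ℝ (gradient F (x + t • d) - gradient F x - hessian F x (t • d)) d) t := by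
    intro t
    have h1 : HasDerivAt (fun s : ℝ => x + s • d) d t := by
      simpa using ((hasDerivAt_id t).smul_const d).const_add x
    have h2 := (hF.differentiable (x + t • d)).hasGradientAt.hasFDerivAt.comp_hasDerivAt t h1
    have h3 := ((hasDerivAt_id t).mul_const (inner ℝ (gradient F x) d : ℝ))
    have h4 := (((hasDerivAt_id t).pow 2).div_const 2).mul_const (inner ℝ (hessian F x d) d : ℝ)
    refine ((h2.sub h3).sub h4).congr_deriv ?_
    simp [inner_sub_left, real_inner_smul_left]
  have h := (convex_Icc (0 : ℝ) 1).norm_image_sub_le_of_norm_hasDerivWithin_le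
    (fun t _ => (hder t).hasDerivWithinAt) (C := LH * ‖d‖ ^ 3) ?_
    (Set.left_mem_Icc.2 zero_le_one) (Set.right_mem_Icc.2 zero_le_one)
  · have := (abs_le.1 (Real.norm_eq_abs _ ▸ h)).2
    simp only [one_smul, zero_smul, add_zero, sub_zero, norm_one, mul_one, one_mul,
      zero_mul] at this
    linarith
  · intro t ht
    have h1 := hF.gradient_taylor hLH hX hx (hseg t ht)
    rw [add_sub_cancel_left, norm_smul, Real.norm_eq_abs, abs_of_nonneg ht.1] at h1
    have h0 : t * ‖d‖ ≤ ‖d‖ := mul_le_of_le_one_left (norm_nonneg _) ht.2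
    have h0' : 0 ≤ t * ‖d‖ := mul_nonneg ht.1 (norm_nonneg _)
    have h2 : LH * (t * ‖d‖) ^ 2 ≤ LH * ‖d‖ ^ 2 := by gcongr
    refine (norm_inner_le_norm _ _).trans ?_
    calc _ ≤ LH * ‖d‖ ^ 2 * ‖d‖ := by gcongr; exact h1.trans h2
      _ = _ := by ring

/-! ### One step of the algorithm -/

theorem mul_le_cube_add {a b : ℝ} (ha : 0 ≤ a) (hb : 0 ≤ b) :
    a * b ≤ b ^ 3 / 2 + 2 * (a * √a) := by
  obtain ⟨r, hr, rfl⟩ : ∃ r, 0 ≤ r ∧ a = r ^ 2 := ⟨√a, Real.sqrt_nonneg _, (Real.sq_sqrt ha).symm⟩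
  rw [Real.sqrt_sq hr]
  rcases le_total b (2 * r) with h | h
  · nlinarith [pow_nonneg hb 3, mul_le_mul_of_nonneg_left h (sq_nonneg r)]
  · have : r ^ 2 * 2 ≤ b ^ 2 := by nlinarith
    nlinarith [mul_le_mul_of_nonneg_right this hb, pow_nonneg hr 3]

theorem mul_sq_le_cube_add {q b : ℝ} (hq : 0 ≤ q) (hb : 0 ≤ b) :
    q * b ^ 2 ≤ b ^ 3 + q ^ 3 := by
  rcases le_total q b with h | h
  · nlinarith [mul_le_mul_of_nonneg_right h (sq_nonneg b), pow_nonneg hq 3]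
  · have : b ^ 2 ≤ q ^ 2 := by gcongr
    nlinarith [mul_le_mul_of_nonneg_left this hq, pow_nonneg hb 3]

/-- Decrease of `F` and size of the new gradient along a regularized Newton step computed from an
inexact gradient `g` and an inexact Hessian `H`. -/
theorem IsSmoothOn.newton_step (hF : IsSmoothOn F X Lg LH) (hLH : 0 ≤ LH) (hX : Convex ℝ X)
    {x d g : Euc n} {H : Euc n →L[ℝ] Euc n} {lam tol e : ℝ} (hx : x ∈ X) (hy : x + d ∈ X)
    (htol : 0 ≤ tol)
    (heq : H d + lam • d = -g) (hnn : 0 ≤ inner ℝ (H d + lam • d) d)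
    (hlow : (4 * LH + 8) / 2 * ‖d‖ - tol ≤ lam) (hup : lam ≤ 2 * (4 * LH + 8) * ‖d‖ + tol)
    (he : ‖gradient F x - g‖ ≤ e) :
    F (x + d) ≤ F x - ‖d‖ ^ 3 + 2 * (e * √e) + (‖hessian F x - H‖ + tol) ^ 3 / 2 ∧
    ‖gradient F (x + d)‖ ≤
      (9 * LH + 17) * ‖d‖ ^ 2 + e + (‖hessian F x - H‖ + tol) ^ 2 := by
  have he0 : 0 ≤ e := (norm_nonneg _).trans he
  have hd0 := norm_nonneg d
  have hE := norm_nonneg (hessian F x - H)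
  set E := ‖hessian F x - H‖ with hEdef
  have hEd : ‖(hessian F x - H) d‖ ≤ E * ‖d‖ := (hessian F x - H).le_opNorm d
  have i1 : inner ℝ (gradient F x) d ≤ inner ℝ g d + e * ‖d‖ := by
    have h1 : inner ℝ (gradient F x - g) d ≤ ‖gradient F x - g‖ * ‖d‖ := real_inner_le_norm _ _
    rw [inner_sub_left] at h1
    nlinarith [mul_le_mul_of_nonneg_right he hd0]
  have i2 : inner ℝ (hessian F x d) d ≤ inner ℝ (H d) d + E * ‖d‖ ^ 2 := by
    have h1 : inner ℝ ((hessian F x - H) d) d ≤ ‖(hessian F x - H) d‖ * ‖d‖ :=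
      real_inner_le_norm _ _
    rw [sub_apply, inner_sub_left] at h1
    have := mul_le_mul_of_nonneg_right hEd hd0
    rw [sub_apply] at this
    nlinarith
  have i3 : inner ℝ g d = -(inner ℝ (H d) d + lam * ‖d‖ ^ 2) := by
    rw [show g = -(H d + lam • d) by rw [heq, neg_neg], inner_neg_left, inner_add_left,
      real_inner_smul_left, real_inner_self_eq_norm_sq]
  rw [inner_add_left, real_inner_smul_left, real_inner_self_eq_norm_sq] at hnn
  constructor
  -- The model terms are at most `-lam ‖d‖ ^ 2 / 2`, and half of `Ce / 2 = 2 LH + 4` gives `-(LH +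
  -- 2) ‖d‖ ^ 3`. The Taylor remainder takes `LH`, and each of the two Young inequalities `1/2`,
  -- leaving `-‖d‖ ^ 3`.
  · have h1 := hF.taylor_le hLH hX hx hy
    have h2 := mul_le_cube_add he0 hd0
    have h3 := mul_sq_le_cube_add (add_nonneg hE htol) hd0
    have h4 := mul_le_mul_of_nonneg_right hlow (sq_nonneg ‖d‖)
    nlinarith
  · have h1 := hF.gradient_taylor hLH hX hx hy
    rw [add_sub_cancel_left] at h1
    have h2 : gradient F (x + d) = (gradient F (x + d) - gradient F x - hessian F x d) +
        (gradient F x - g) + (hessian F x - H) d + -(lam • d) := by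
      rw [← neg_eq_iff_eq_neg] at heq
      rw [sub_apply, ← heq]
      abel
    have h3 : ‖lam • d‖ ≤ (2 * (4 * LH + 8) * ‖d‖ + tol) * ‖d‖ := by
      rw [norm_smul, Real.norm_eq_abs]
      refine mul_le_mul_of_nonneg_right (abs_le.2 ⟨?_, hup⟩) hd0
      nlinarith [mul_nonneg hLH hd0]
    have h4 : ‖gradient F (x + d)‖ ≤ LH * ‖d‖ ^ 2 + e + E * ‖d‖ +
        (2 * (4 * LH + 8) * ‖d‖ + tol) * ‖d‖ := by
      rw [h2]
      refine (norm_add_le _ _).trans (add_le_add ((norm_add_le _ _).trans (add_le_add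
        ((norm_add_le _ _).trans (add_le_add h1 he)) hEd)) ?_)
      rwa [norm_neg]
    nlinarith [sq_nonneg (E + tol - ‖d‖), sq_nonneg (E + tol), sq_nonneg ‖d‖]

/-- `D` is the step length. Perturbing the gradient costs at most `εeig` in its error; `εls ≤ εeig`
makes the final bracket short enough for the line search estimate. -/
theorem SHSODMStep.newton_step {p : SHSODMParams} (hF : IsSmoothOn F X Lg LH) (hLH : 0 ≤ LH)
    (hX : Convex ℝ X) {x x' g : Euc n} {H : Euc n →L[ℝ] Euc n} (hCe : p.Ce = 4 * LH + 8)
    (hls : 0 < p.εls) (hle : p.εls ≤ p.εeig) (hH : IsSelfAdjoint H)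
    (hx : x ∈ X) (hx' : x' ∈ X) (h : SHSODMStep p g H x x') :
    ∃ D : ℝ, 0 ≤ D ∧
    F x' ≤ F x - D ^ 3 + 2 * ((‖gradient F x - g‖ + p.εeig) * √(‖gradient F x - g‖ + p.εeig)) +
      (‖hessian F x - H‖ + p.εls) ^ 3 / 2 ∧
    ‖gradient F x'‖ ≤ (9 * LH + 17) * D ^ 2 + (‖gradient F x - g‖ + p.εeig) +
      (‖hessian F x - H‖ + p.εls) ^ 2 := by
  obtain ⟨g', l, r, hg', hl, hr, rfl⟩ := h
  have heig : 0 < p.εeig := hls.trans_le hle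
  obtain ⟨w, hw⟩ := hg'.hasLeastDirection hH heig
  obtain ⟨lam, h1, h2, h3, h4⟩ := lineSearch_spec (by rw [hCe]; positivity) heig hls hle hw hH
    hl hr rfl
  rw [hCe] at h3 h4
  refine ⟨_, norm_nonneg _, hF.newton_step hLH hX hx hx' hls.le h1 h2 (by rwa [← hCe] at h3 ⊢)
    (by rwa [← hCe] at h4 ⊢) ?_⟩
  rcases hg' with ⟨-, rfl⟩ | ⟨-, u, -, hu, -, rfl⟩
  · linarith
  · rw [← sub_sub]
    refine (norm_sub_le _ _).trans ?_
    rw [norm_smul, hu, Real.norm_eq_abs, abs_of_pos heig, mul_one]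

end

/-! ### The scalar recursion -/

/-- When `h > C q ^ 2`, `t = √(h - Cw q ^ 2)` dominates both `a q` and `√(h - C q ^ 2)`, while the
second bound on `h` gives `t ≤ a D` or `t ≤ b √e`. So, up to `e ^ (3/2)`, the decrease `D ^ 3` is at
least `(t / a) ^ 3`: one half absorbs `q ^ 3 / 2`, the other is the gain. -/
theorem pos_part_recursion {c₁ Cw : ℝ} (hc₁ : 0 < c₁) (hCw : 0 < Cw) :
    ∃ c C : ℝ, 0 < c ∧ 0 < C ∧ ∀ f h D e q : ℝ, 0 ≤ f → 0 ≤ D → 0 ≤ e → 0 ≤ q →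
      (0 < h → h ≤ f - D ^ 3 + 2 * (e * √e) + q ^ 3 / 2 ∧
        h ≤ c₁ * D ^ 2 + Cw * e + Cw * q ^ 2) →
      max (h - C * q ^ 2) 0 + c * (max (h - C * q ^ 2) 0 * √(max (h - C * q ^ 2) 0)) ≤
        f + C * (e * √e) := by
  obtain ⟨a, ha0, ha2⟩ : ∃ a, 0 < a ∧ 2 * c₁ = a ^ 2 :=
    ⟨√(2 * c₁), Real.sqrt_pos.2 (by positivity), (Real.sq_sqrt (by positivity)).symm⟩
  obtain ⟨b, hb0, hb2⟩ : ∃ b, 0 < b ∧ 2 * Cw = b ^ 2 :=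
    ⟨√(2 * Cw), Real.sqrt_pos.2 (by positivity), (Real.sq_sqrt (by positivity)).symm⟩
  refine ⟨1 / (2 * a ^ 3), Cw + 2 * c₁ + 2 + b ^ 3 / a ^ 3, by positivity, by positivity, ?_⟩
  intro f h D e q hf hD he hq hh
  obtain ⟨C, hC⟩ : ∃ C, C = Cw + 2 * c₁ + 2 + b ^ 3 / a ^ 3 := ⟨_, rfl⟩
  rw [← hC]
  have hC0 : 0 < b ^ 3 / a ^ 3 := by positivity
  have hCpos : 0 < C := by rw [hC]; positivity
  have hee : 0 ≤ e * √e := mul_nonneg he (Real.sqrt_nonneg _)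
  rcases le_or_gt (h - C * q ^ 2) 0 with hneg | hpos
  · rw [max_eq_right hneg]
    simp only [zero_mul, mul_zero, add_zero]
    positivity
  rw [max_eq_left hpos.le]
  obtain ⟨hA, hB⟩ := hh (by nlinarith [mul_nonneg hCpos.le (sq_nonneg q)])
  obtain ⟨s, hs, hsy⟩ : ∃ s, 0 < s ∧ h - C * q ^ 2 = s ^ 2 :=
    ⟨√(h - C * q ^ 2), Real.sqrt_pos.2 hpos, (Real.sq_sqrt hpos.le).symm⟩
  obtain ⟨r, hr, rfl⟩ : ∃ r, 0 ≤ r ∧ e = r ^ 2 := ⟨√e, Real.sqrt_nonneg _, (Real.sq_sqrt he).symm⟩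
  rw [Real.sqrt_sq hr] at hA hee ⊢
  rw [hsy, Real.sqrt_sq hs.le]
  -- the excess of `h` over the part of the noise carried by `q`
  obtain ⟨y, hy⟩ : ∃ y, y = h - Cw * q ^ 2 := ⟨_, rfl⟩
  have hy1 : s ^ 2 + a ^ 2 * q ^ 2 ≤ y := by
    have k1 := mul_nonneg hC0.le (sq_nonneg q)
    have k2 := sq_nonneg q
    rw [hC] at hsy
    rw [hy, ← ha2]
    linarith
  have hypos : 0 < y := by nlinarith [sq_nonneg (a * q)]
  obtain ⟨t, ht, hty⟩ : ∃ t, 0 < t ∧ y = t ^ 2 :=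
    ⟨√y, Real.sqrt_pos.2 hypos, (Real.sq_sqrt hypos.le).symm⟩
  rw [hty] at hy1
  have hst : s ≤ t := by nlinarith [sq_nonneg (a * q)]
  have haq : a * q ≤ t := by
    by_contra! hlt
    nlinarith [sq_nonneg s]
  have hyB : t ^ 2 ≤ c₁ * D ^ 2 + Cw * r ^ 2 := by linarith
  have hcube : t ^ 3 ≤ a ^ 3 * D ^ 3 + b ^ 3 * r ^ 3 := by
    have hcases : t ≤ a * D ∨ t ≤ b * r := by
      by_contra! hcon
      have k1 : (a * D) ^ 2 < t ^ 2 := by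
        have := hcon.1
        gcongr
      have k2 : (b * r) ^ 2 < t ^ 2 := by
        have := hcon.2
        gcongr
      nlinarith
    have n1 : 0 ≤ a ^ 3 * D ^ 3 := by positivity
    have n2 : 0 ≤ b ^ 3 * r ^ 3 := by positivity
    rcases hcases with k | k
    · have : t ^ 3 ≤ (a * D) ^ 3 := by gcongr
      rw [mul_pow] at this; linarith
    · have : t ^ 3 ≤ (b * r) ^ 3 := by gcongr
      rw [mul_pow] at this; linarith
  have hq3 : (a * q) ^ 3 ≤ t ^ 3 := by gcongr
  have hs3 : s ^ 3 ≤ t ^ 3 := by gcongr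
  have ha3 : 0 < a ^ 3 := by positivity
  have e1 : t ^ 3 / a ^ 3 ≤ D ^ 3 + b ^ 3 / a ^ 3 * r ^ 3 := by
    rw [div_le_iff₀ ha3]
    have : (D ^ 3 + b ^ 3 / a ^ 3 * r ^ 3) * a ^ 3 = a ^ 3 * D ^ 3 + b ^ 3 * r ^ 3 := by
      field_simp
    linarith
  have e2 : q ^ 3 ≤ t ^ 3 / a ^ 3 := by
    rw [le_div_iff₀ ha3]
    linarith [mul_pow a q 3]
  have e3 : 1 / (2 * a ^ 3) * (s ^ 2 * s) ≤ t ^ 3 / a ^ 3 / 2 := by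
    have : 1 / (2 * a ^ 3) * (s ^ 2 * s) = s ^ 3 / a ^ 3 / 2 := by field_simp
    rw [this]
    gcongr
  have hr3 : 0 ≤ (Cw + 2 * c₁) * r ^ 3 := by positivity
  have e4 : C * (r ^ 2 * r) = (Cw + 2 * c₁) * r ^ 3 + 2 * r ^ 3 + b ^ 3 / a ^ 3 * r ^ 3 := by
    rw [hC]; ring
  have e5 : 0 ≤ C * q ^ 2 := by positivity
  linarith

/-- Tangent line bound for `y ↦ y ^ (3 / 2)`. -/
theorem tangent_le_mul_sqrt {y τ : ℝ} (hy : 0 ≤ y) (hτ : 0 ≤ τ) :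
    3 / 2 * √τ * y - τ * √τ / 2 ≤ y * √y := by
  obtain ⟨a, ha, rfl⟩ : ∃ a, 0 ≤ a ∧ y = a ^ 2 := ⟨√y, Real.sqrt_nonneg _, (Real.sq_sqrt hy).symm⟩
  obtain ⟨b, hb, rfl⟩ : ∃ b, 0 ≤ b ∧ τ = b ^ 2 := ⟨√τ, Real.sqrt_nonneg _, (Real.sq_sqrt hτ).symm⟩
  rw [Real.sqrt_sq ha, Real.sqrt_sq hb]
  nlinarith [mul_nonneg (sq_nonneg (a - b)) (by positivity : 0 ≤ a + b / 2)]

theorem mul_sqrt_le_scale {e s : ℝ} (he : 0 ≤ e) (hs : 0 < s) :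
    e * √e ≤ s * √s + e ^ 2 / √s := by
  rcases le_total e s with h | h
  · have h1 : √e ≤ √s := Real.sqrt_le_sqrt h
    have h2 : e * √e ≤ s * √s := by gcongr
    have : 0 ≤ e ^ 2 / √s := by positivity
    linarith
  · have hss : 0 < √s := Real.sqrt_pos.2 hs
    have h1 : √e * √s ≤ e := by
      calc √e * √s ≤ √e * √e := by gcongr
        _ = e := Real.mul_self_sqrt he
    have h2 : e * √e ≤ e ^ 2 / √s := by
      rw [le_div_iff₀ hss]
      nlinarith [mul_le_mul_of_nonneg_left h1 he]
    have : 0 ≤ s * √s := by positivity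
    linarith

/-- A sequence with `a (k+1) + c a (k+1) ^ (3/2) ≤ a k` as long as it stays above `ε` is below
`ε` after `O(ε ^ (-1/2))` steps. -/
theorem lt_of_cubic_decrease {c M : ℝ} (hc : 0 < c) (hM : 0 < M) :
    ∃ κ : ℝ, 0 < κ ∧ ∀ (ε : ℝ) (K : ℕ) (a : ℕ → ℝ), 0 < ε → a 0 ≤ M →
      (∀ k < K, ε ≤ a (k + 1) → a (k + 1) + c * (a (k + 1) * √(a (k + 1))) ≤ a k) →
      κ < K * √ε → a K < ε := by
  -- `1 / √a` grows by a fixed amount at each step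
  set κ := c / (6 * (1 + c * √M)) with hκ
  have hκ0 : 0 < κ := by positivity
  refine ⟨1 / κ, by positivity, ?_⟩
  intro ε K a hε h0 hstep hK
  by_contra! hge
  -- Backward induction: if the last term is at least `ε`, so are all earlier ones, and the
  -- recursion is active at every step.
  have hall : ∀ j, j ≤ K → ε ≤ a (K - j) := by
    intro j
    induction j with
    | zero => intro _; simpa using hge
    | succ j ih =>
      intro hj
      have h1 := ih (by omega)
      have h2 := hstep (K - (j + 1)) (by omega) (by rwa [show K - (j + 1) + 1 = K - j by omega])
      rw [show K - (j + 1) + 1 = K - j by omega] at h2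
      have h3 : 0 < a (K - j) := hε.trans_le h1
      have : 0 ≤ c * (a (K - j) * √(a (K - j))) := by positivity
      linarith
  have hall' : ∀ k ≤ K, ε ≤ a k := fun k hk => by
    have := hall (K - k) (by omega)
    rwa [show K - (K - k) = k by omega] at this
  have hgrow : ∀ k ≤ K, a k ≤ M ∧ k * κ * √(a k) ≤ 1 := by
    intro k
    induction k with
    | zero => intro _; exact ⟨h0, by simp⟩
    | succ k ih =>
      intro hk
      obtain ⟨i1, i2⟩ := ih (by omega)
      have h1 := hall' k (by omega)
      have h2 := hall' (k + 1) hk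
      have h3 := hstep k (by omega) h2
      obtain ⟨u, hu, hu2⟩ : ∃ u, 0 < u ∧ a k = u ^ 2 :=
        ⟨√(a k), Real.sqrt_pos.2 (by linarith), (Real.sq_sqrt (by linarith)).symm⟩
      obtain ⟨v, hv, hv2⟩ : ∃ v, 0 < v ∧ a (k + 1) = v ^ 2 :=
        ⟨√(a (k + 1)), Real.sqrt_pos.2 (by linarith), (Real.sq_sqrt (by linarith)).symm⟩
      rw [hu2, Real.sqrt_sq hu.le] at i2
      rw [hv2, hu2, Real.sqrt_sq hv.le] at h3
      rw [hu2] at i1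
      have hcv : 0 < c * v ^ 3 := by positivity
      have hvu : v ≤ u := by
        by_contra! hlt
        nlinarith
      have huM : u ≤ √M := Real.le_sqrt_of_sq_le i1
      -- This is `1 / v - 1 / u ≥ κ` cleared of denominators.
      have hgap : κ * (v * u) ≤ u - v := by
        have g1 : c * v ^ 3 ≤ (u - v) * (u + v) := by nlinarith
        -- either `u ≥ 2 v` or `u + v ≤ 3 v`
        have hκ1 : κ * (6 * (1 + c * √M)) = c := by rw [hκ]; field_simp
        have hm : 0 ≤ c * √M := by positivity
        rcases le_total (2 * v) u with h | h
        · have k1 : κ * √M ≤ 1 / 6 := by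
            rw [hκ, div_mul_eq_mul_div, div_le_iff₀ (by positivity)]
            linarith
          have k2 : κ * v ≤ κ * √M := by gcongr; exact hvu.trans huM
          nlinarith
        · have k1 : κ * 6 ≤ c := by nlinarith [mul_nonneg hκ0.le hm]
          have k2 : c * v ^ 2 ≤ 3 * (u - v) := by
            have : v * (c * v ^ 2) ≤ v * (3 * (u - v)) := by nlinarith
            exact le_of_mul_le_mul_left this hv
          have k3 : κ * (v * u) ≤ κ * (2 * v ^ 2) :=
            mul_le_mul_of_nonneg_left (by nlinarith) hκ0.le
          nlinarith [mul_le_mul_of_nonneg_right k1 (sq_nonneg v)]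
      refine ⟨by rw [hv2]; nlinarith, ?_⟩
      rw [hv2, Real.sqrt_sq hv.le]
      push_cast
      have : (k + 1) * κ * v * u ≤ 1 * u := by
        nlinarith [mul_le_mul_of_nonneg_right i2 hv.le]
      exact le_of_mul_le_mul_right this hu
  obtain ⟨-, h2⟩ := hgrow K le_rfl
  have h3 : √ε ≤ √(a K) := Real.sqrt_le_sqrt hge
  rw [div_lt_iff₀ hκ0] at hK
  have : (K : ℝ) * κ * √ε ≤ K * κ * √(a K) := by gcongr
  nlinarith

/-! ### Variance of batch means -/

/-- Mean square of the average of independent centred real variables. -/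
theorem integral_sq_mean_le {Ω : Type*} [MeasurableSpace Ω] {P : Measure Ω}
    [IsProbabilityMeasure P] {N : ℕ} (hN : 0 < N) {Z : Fin N → Ω → ℝ} {s : ℝ}
    (hZ : ∀ i, MemLp (Z i) 2 P) (hind : iIndepFun Z P) (h0 : ∀ i, ∫ ω, Z i ω ∂P = 0)
    (hs : ∀ i, ∫ ω, Z i ω ^ 2 ∂P ≤ s) :
    Integrable (fun ω => ((N : ℝ)⁻¹ * ∑ i, Z i ω) ^ 2) P ∧
      ∫ ω, ((N : ℝ)⁻¹ * ∑ i, Z i ω) ^ 2 ∂P ≤ s / N := by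
  have hsum : MemLp (∑ i, Z i) 2 P := memLp_finsetSum' _ fun i _ => hZ i
  have hint : Integrable (fun ω => (∑ i, Z i ω) ^ 2) P := by
    simpa using hsum.integrable_sq
  have hvar : ∫ ω, (∑ i, Z i ω) ^ 2 ∂P = ∑ i, ∫ ω, Z i ω ^ 2 ∂P := by
    have h1 := IndepFun.variance_sum (s := Finset.univ) (fun i _ => hZ i)
      (fun i _ j _ hij => hind.indepFun hij)
    rw [variance_eq_integral hsum.aemeasurable] at h1
    have h2 : ∫ ω, (∑ i, Z i) ω ∂P = 0 := by
      simp only [Finset.sum_apply]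
      rw [integral_finsetSum _ fun i _ => (hZ i).integrable (by norm_num)]
      simp [h0]
    rw [h2] at h1
    simp only [Finset.sum_apply, sub_zero] at h1
    rw [h1]
    refine Finset.sum_congr rfl fun i _ => ?_
    rw [variance_eq_integral (hZ i).aemeasurable, h0]
    simp
  simp only [mul_pow]
  refine ⟨hint.const_mul _, ?_⟩
  rw [integral_const_mul, hvar]
  have h3 : ∑ i, ∫ ω, Z i ω ^ 2 ∂P ≤ N * s := by
    simpa using Finset.sum_le_sum fun i (_ : i ∈ Finset.univ) => hs i
  have hN' : (0 : ℝ) < N := by exact_mod_cast hN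
  calc _ ≤ ((N : ℝ)⁻¹) ^ 2 * (N * s) := by gcongr
    _ = _ := by field_simp

/-- The mean square error of a batch mean in a finite-dimensional space is `O(σ² / N)`. -/
theorem exists_batch_variance (V : Type*) [NormedAddCommGroup V] [NormedSpace ℝ V]
    [FiniteDimensional ℝ V] [MeasurableSpace V] [BorelSpace V] :
    ∃ C : ℝ, 0 < C ∧ ∀ (Ξ : Type u) [MeasurableSpace Ξ] (D : Measure Ξ) (Ω : Type v)
      [MeasurableSpace Ω] (P : Measure Ω) [IsProbabilityMeasure P] (N : ℕ) (A : Ξ → V) (m : V)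
      (σ : ℝ) (ξ : Fin N → Ω → Ξ), 0 < N → Measurable A → Integrable A D → ∫ z, A z ∂D = m →
      Integrable (fun z => ‖m - A z‖ ^ 2) D → ∫ z, ‖m - A z‖ ^ 2 ∂D ≤ σ ^ 2 →
      (∀ i, MeasurePreserving (ξ i) P D) → iIndepFun ξ P →
      ∫⁻ ω, ENNReal.ofReal (‖m - batchMean (fun i => A (ξ i ω))‖ ^ 2) ∂P ≤
        ENNReal.ofReal (C * σ ^ 2 / N) := by
  have : ProperSpace V := FiniteDimensional.proper ℝ V
  -- The norm of `V` need not be Euclidean (operator norms of Hessians), so variances are added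
  -- coordinatewise; the equivalence of norms costs a factor depending only on `V`.
  let e : V ≃L[ℝ] EuclideanSpace ℝ (Fin (Module.finrank ℝ V)) :=
    ContinuousLinearEquiv.ofFinrankEq (by simp)
  let ℓ : Fin (Module.finrank ℝ V) → V →L[ℝ] ℝ := fun c =>
    (EuclideanSpace.proj c).comp (e : V →L[ℝ] EuclideanSpace ℝ (Fin (Module.finrank ℝ V)))
  set a := ‖(e.symm : EuclideanSpace ℝ (Fin (Module.finrank ℝ V)) →L[ℝ] V)‖ with ha
  have hup : ∀ v, ‖v‖ ^ 2 ≤ a ^ 2 * ∑ c, (ℓ c v) ^ 2 := by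
    intro v
    have h1 := (e.symm : EuclideanSpace ℝ (Fin (Module.finrank ℝ V)) →L[ℝ] V).le_opNorm (e v)
    simp only [ContinuousLinearEquiv.coe_coe, ContinuousLinearEquiv.symm_apply_apply] at h1
    have h2 : ‖e v‖ ^ 2 = ∑ c, (ℓ c v) ^ 2 := by
      rw [EuclideanSpace.norm_sq_eq]
      simp [ℓ]
    rw [← h2, ← mul_pow]
    gcongr
  refine ⟨a ^ 2 * ∑ c, ‖ℓ c‖ ^ 2 + 1, by positivity, ?_⟩
  intro Ξ _ D Ω _ P _ N A m σ ξ hN hA hAi hm hvi hv hξ hind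
  have hD : IsProbabilityMeasure D := by
    rw [← (hξ ⟨0, hN⟩).map_eq]
    exact Measure.isProbabilityMeasure_map (hξ ⟨0, hN⟩).aemeasurable
  have hN' : (0 : ℝ) < N := by exact_mod_cast hN
  have hmean : ∀ w : Fin N → V, m - batchMean w = (N : ℝ)⁻¹ • ∑ i, (m - w i) := by
    intro w
    simp only [batchMean, Finset.sum_sub_distrib, Finset.sum_const, Finset.card_univ,
      Fintype.card_fin, smul_sub]
    rw [← Nat.cast_smul_eq_nsmul ℝ, smul_smul, inv_mul_cancel₀ hN'.ne', one_smul]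
  have hcoord : ∀ c, Integrable (fun ω => (ℓ c (m - batchMean fun i => A (ξ i ω))) ^ 2) P ∧
      ∫ ω, (ℓ c (m - batchMean fun i => A (ξ i ω))) ^ 2 ∂P ≤ ‖ℓ c‖ ^ 2 * σ ^ 2 / N := by
    intro c
    let B : Ξ → ℝ := fun z => ℓ c (m - A z)
    have hB : Measurable B := (ℓ c).measurable.comp (measurable_const.sub hA)
    have hle : ∀ z, B z ^ 2 ≤ ‖ℓ c‖ ^ 2 * ‖m - A z‖ ^ 2 := by
      intro z
      rw [← mul_pow, ← sq_abs]
      have := (ℓ c).le_opNorm (m - A z)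
      gcongr
      exact this
    have hBi : Integrable (fun z => B z ^ 2) D := by
      refine (hvi.const_mul (‖ℓ c‖ ^ 2)).mono' (hB.pow_const 2).aestronglyMeasurable ?_
      filter_upwards with z
      rw [Real.norm_eq_abs, abs_of_nonneg (sq_nonneg _)]
      exact hle z
    have hB0 : ∫ z, B z ∂D = 0 := by
      have h1 := (ℓ c).integral_comp_comm ((integrable_const m).sub hAi)
      have h2 : ∫ z, (m - A z) ∂D = 0 := by
        rw [integral_sub (integrable_const m) hAi, hm]
        simp
      simp only [Pi.sub_apply] at h1
      rw [h2, map_zero] at h1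
      exact h1
    have h := integral_sq_mean_le (P := P) hN (Z := fun i => B ∘ ξ i)
      (s := ‖ℓ c‖ ^ 2 * σ ^ 2) ?_ (hind.comp _ fun _ => hB) ?_ ?_
    · have he : ∀ ω, ℓ c (m - batchMean fun i => A (ξ i ω)) =
          (N : ℝ)⁻¹ * ∑ i, (B ∘ ξ i) ω := by
        intro ω
        rw [hmean, map_smul, map_sum, smul_eq_mul]
        rfl
      simp only [he]
      exact h
    · intro i
      exact ((memLp_two_iff_integrable_sq hB.aestronglyMeasurable).2 hBi).comp_measurePreserving
        (hξ i)
    · intro i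
      rw [← hB0, ← (hξ i).map_eq, integral_map (hξ i).aemeasurable hB.aestronglyMeasurable]
      rfl
    · intro i
      have h1 : ∫ ω, (B ∘ ξ i) ω ^ 2 ∂P = ∫ z, B z ^ 2 ∂D := by
        rw [← (hξ i).map_eq, integral_map (hξ i).aemeasurable
          (hB.pow_const 2).aestronglyMeasurable]
        rfl
      rw [h1]
      calc ∫ z, B z ^ 2 ∂D ≤ ∫ z, ‖ℓ c‖ ^ 2 * ‖m - A z‖ ^ 2 ∂D :=
            integral_mono hBi (hvi.const_mul _) hle
        _ = ‖ℓ c‖ ^ 2 * ∫ z, ‖m - A z‖ ^ 2 ∂D := integral_const_mul _ _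
        _ ≤ _ := by gcongr
  have hint : Integrable
      (fun ω => a ^ 2 * ∑ c, (ℓ c (m - batchMean fun i => A (ξ i ω))) ^ 2) P :=
    (integrable_finsetSum _ fun c _ => (hcoord c).1).const_mul _
  calc _ ≤ ∫⁻ ω, ENNReal.ofReal
          (a ^ 2 * ∑ c, (ℓ c (m - batchMean fun i => A (ξ i ω))) ^ 2) ∂P :=
        lintegral_mono fun ω => ENNReal.ofReal_le_ofReal (hup _)
    _ = ENNReal.ofReal
          (∫ ω, a ^ 2 * ∑ c, (ℓ c (m - batchMean fun i => A (ξ i ω))) ^ 2 ∂P) :=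
        (ofReal_integral_eq_lintegral_ofReal hint (ae_of_all _ fun ω => by positivity)).symm
    _ ≤ _ := by
        refine ENNReal.ofReal_le_ofReal ?_
        rw [integral_const_mul, integral_finsetSum _ fun c _ => (hcoord c).1]
        have h1 : ∑ c, ∫ ω, (ℓ c (m - batchMean fun i => A (ξ i ω))) ^ 2 ∂P ≤
            ∑ c, ‖ℓ c‖ ^ 2 * σ ^ 2 / N := Finset.sum_le_sum fun c _ => (hcoord c).2
        have h2 : ∑ c, ‖ℓ c‖ ^ 2 * σ ^ 2 / N = (∑ c, ‖ℓ c‖ ^ 2) * σ ^ 2 / N := by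
          rw [Finset.sum_mul, Finset.sum_div]
        rw [h2] at h1
        calc _ ≤ a ^ 2 * ((∑ c, ‖ℓ c‖ ^ 2) * σ ^ 2 / N) := by gcongr
          _ = (a ^ 2 * ∑ c, ‖ℓ c‖ ^ 2) * σ ^ 2 / N := by ring
          _ ≤ _ := by gcongr; linarith

/-- A bound on partial means transfers to an independent random argument. -/
theorem lintegral_le_of_indepFun {Ω E B : Type*} [MeasurableSpace Ω] [MeasurableSpace E]
    [MeasurableSpace B] {P : Measure Ω} [IsProbabilityMeasure P] {x : Ω → E} {y : Ω → B}
    (hx : Measurable x) (hy : Measurable y) (hxy : IndepFun x y P) {φ : E × B → ENNReal}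
    (hφ : Measurable φ) {X : Set E} {c : ENNReal} (hX : ∀ᵐ ω ∂P, x ω ∈ X)
    (hc : ∀ z ∈ X, ∫⁻ ω, φ (z, y ω) ∂P ≤ c) : ∫⁻ ω, φ (x ω, y ω) ∂P ≤ c := by
  have hpx : IsProbabilityMeasure (P.map x) := Measure.isProbabilityMeasure_map hx.aemeasurable
  have hpy : IsProbabilityMeasure (P.map y) := Measure.isProbabilityMeasure_map hy.aemeasurable
  have h1 := hxy.map_prod_eq_prod_map_map hx.aemeasurable hy.aemeasurable
  rw [← lintegral_map hφ (hx.prodMk hy), h1, lintegral_prod _ hφ.aemeasurable]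
  have hmeas := hφ.lintegral_prod_right' (ν := P.map y)
  -- `X` need not be measurable, so the almost sure statement is pulled back through the measurable
  -- set where the bound holds.
  have hae : ∀ᵐ z ∂(P.map x), ∫⁻ w, φ (z, w) ∂(P.map y) ≤ c := by
    rw [ae_map_iff hx.aemeasurable (measurableSet_le hmeas measurable_const)]
    filter_upwards [hX] with ω hω
    exact (lintegral_map (hφ.comp measurable_prodMk_left) hy).trans_le (hc _ hω)
  calc _ ≤ ∫⁻ _, c ∂(P.map x) := lintegral_mono_ae hae
    _ = c := by simp

theorem measurable_batchMean {V : Type*} [NormedAddCommGroup V] [NormedSpace ℝ V]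
    [SecondCountableTopology V] [MeasurableSpace V] [BorelSpace V] {α : Type*}
    [MeasurableSpace α] {N : ℕ} {f : Fin N → α → V} (hf : ∀ i, Measurable (f i)) :
    Measurable fun a => batchMean fun i => f i a := by
  unfold batchMean
  exact (Finset.measurable_fun_sum _ fun i _ => hf i).const_smul _

/-- Square integrability of the error of a batch mean of an unbiased oracle queried at an
independent random point of `X`. -/
theorem integral_sq_batch_error_le {E V : Type*} [MeasurableSpace E] [NormedAddCommGroup V]
    [NormedSpace ℝ V] [SecondCountableTopology V] [MeasurableSpace V] [BorelSpace V]
    {Ξ : Type*} [MeasurableSpace Ξ] {Ω : Type*} [MeasurableSpace Ω] {P : Measure Ω}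
    [IsProbabilityMeasure P] {N : ℕ} {A : E → Ξ → V} {m : E → V} {b : ℝ} {ξ : Fin N → Ω → Ξ}
    {x : Ω → E} {X : Set E} (hb : 0 ≤ b) (hA : Measurable (Function.uncurry A))
    (hm : Measurable m) (hx : Measurable x) (hξ : ∀ i, Measurable (ξ i))
    (hind : IndepFun x (fun ω i => ξ i ω) P) (hX : ∀ᵐ ω ∂P, x ω ∈ X)
    (hvar : ∀ z ∈ X, ∫⁻ ω, ENNReal.ofReal (‖m z - batchMean (fun i => A z (ξ i ω))‖ ^ 2) ∂P ≤
        ENNReal.ofReal b) :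
    Measurable (fun ω => ‖m (x ω) - batchMean fun i => A (x ω) (ξ i ω)‖) ∧
    Integrable (fun ω => ‖m (x ω) - batchMean fun i => A (x ω) (ξ i ω)‖ ^ 2) P ∧
      ∫ ω, ‖m (x ω) - batchMean fun i => A (x ω) (ξ i ω)‖ ^ 2 ∂P ≤ b := by
  let ψ : E × (Fin N → Ξ) → ℝ := fun q => ‖m q.1 - batchMean fun i => A q.1 (q.2 i)‖
  have hψ : Measurable ψ := by
    refine ((hm.comp measurable_fst).sub (measurable_batchMean fun i => ?_)).norm
    exact hA.comp (measurable_fst.prodMk ((measurable_pi_apply i).comp measurable_snd))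
  have hy : Measurable fun ω i => ξ i ω := measurable_pi_iff.2 hξ
  have h1 := lintegral_le_of_indepFun hx hy hind (φ := fun q => ENNReal.ofReal (ψ q ^ 2))
    (hψ.pow_const 2).ennreal_ofReal hX hvar
  have hmeas : Measurable fun ω => ψ (x ω, fun i => ξ i ω) := hψ.comp (hx.prodMk hy)
  have hint : Integrable (fun ω => ψ (x ω, fun i => ξ i ω) ^ 2) P := by
    refine ⟨(hmeas.pow_const 2).aestronglyMeasurable, ?_⟩
    rw [hasFiniteIntegral_iff_ofReal (ae_of_all _ fun ω => sq_nonneg _)]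
    exact h1.trans_lt ENNReal.ofReal_lt_top
  refine ⟨hmeas, hint, ?_⟩
  rw [← ofReal_integral_eq_lintegral_ofReal hint (ae_of_all _ fun ω => sq_nonneg _)] at h1
  exact (ENNReal.ofReal_le_ofReal_iff hb).1 h1

/-! ### The recursion in expectation -/

/-- `b` is the mean of the positive part. The gradient noise `e ^ (3/2)` is traded for `s ^ (3/2) +
e ^ 2 / √s`, so second moments suffice. Integrability of `h` is a conclusion: the recursion
dominates the positive part. -/
theorem expected_recursion {Ω : Type*} [MeasurableSpace Ω] {P : Measure Ω}
    [IsProbabilityMeasure P] {c C s : ℝ} (hc : 0 < c) (hC : 0 < C) (hs : 0 < s)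
    {f h Eg EH : Ω → ℝ} (hf : Integrable f P) (hh : Measurable h)
    (hEg : Measurable Eg) (hEH : Measurable EH)
    (hh0 : ∀ ω, 0 ≤ h ω) (hEg0 : ∀ ω, 0 ≤ Eg ω)
    (hEgi : Integrable (fun ω => Eg ω ^ 2) P) (hEHi : Integrable (fun ω => EH ω ^ 2) P)
    (hEgs : ∫ ω, Eg ω ^ 2 ∂P ≤ s ^ 2 / 4) (hEHs : ∫ ω, EH ω ^ 2 ∂P ≤ s ^ 2 / 4)
    (hrec : ∀ᵐ ω ∂P, max (h ω - C * (EH ω + s / 2) ^ 2) 0 +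
      c * (max (h ω - C * (EH ω + s / 2) ^ 2) 0 * √(max (h ω - C * (EH ω + s / 2) ^ 2) 0)) ≤
        f ω + C * ((Eg ω + s / 2) * √(Eg ω + s / 2))) :
    Integrable h P ∧ ∃ b, 0 ≤ b ∧ ∫ ω, h ω ∂P ≤ b + C * s ^ 2 ∧
      b + c * (b * √b) ≤ ∫ ω, f ω ∂P + 2 * C * (s * √s) := by
  have hsq : ∀ {E : Ω → ℝ}, Measurable E → Integrable (fun ω => E ω ^ 2) P →
      ∫ ω, E ω ^ 2 ∂P ≤ s ^ 2 / 4 →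
      Integrable (fun ω => (E ω + s / 2) ^ 2) P ∧ ∫ ω, (E ω + s / 2) ^ 2 ∂P ≤ s ^ 2 := by
    intro E hE hEi hEs
    have hle : ∀ ω, (E ω + s / 2) ^ 2 ≤ 2 * E ω ^ 2 + s ^ 2 / 2 := fun ω => by
      nlinarith [sq_nonneg (E ω - s / 2)]
    have hbi : Integrable (fun ω => 2 * E ω ^ 2 + s ^ 2 / 2) P :=
      (hEi.const_mul 2).add (integrable_const _)
    have hi : Integrable (fun ω => (E ω + s / 2) ^ 2) P := by
      refine hbi.mono' ((hE.add_const _).pow_const 2).aestronglyMeasurable ?_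
      filter_upwards with ω
      rw [Real.norm_eq_abs, abs_of_nonneg (sq_nonneg _)]
      exact hle ω
    refine ⟨hi, (integral_mono hi hbi hle).trans ?_⟩
    rw [integral_add (hEi.const_mul 2) (integrable_const _), integral_const_mul]
    simp only [integral_const, probReal_univ, one_smul]
    linarith
  obtain ⟨hei, hes⟩ := hsq hEg hEgi hEgs
  obtain ⟨hqi, hqs⟩ := hsq hEH hEHi hEHs
  set y : Ω → ℝ := fun ω => max (h ω - C * (EH ω + s / 2) ^ 2) 0 with hy
  have hy0 : ∀ ω, 0 ≤ y ω := fun ω => le_max_right _ _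
  have hym : Measurable y :=
    (hh.sub (((hEH.add_const _).pow_const 2).const_mul C)).max measurable_const
  set z : Ω → ℝ := fun ω => f ω + C * (s * √s + (Eg ω + s / 2) ^ 2 / √s) with hz
  have hzi : Integrable z P :=
    hf.add (((integrable_const _).add (hei.div_const _)).const_mul C)
  have hyz : ∀ᵐ ω ∂P, y ω + c * (y ω * √(y ω)) ≤ z ω := by
    filter_upwards [hrec] with ω hω
    refine hω.trans ?_
    have h1 := mul_sqrt_le_scale (add_nonneg (hEg0 ω) (by positivity : 0 ≤ s / 2)) hs
    simp only [hz]
    gcongr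
  have hyi : Integrable y P := by
    refine hzi.mono' hym.aestronglyMeasurable ?_
    filter_upwards [hyz] with ω hω
    rw [Real.norm_eq_abs, abs_of_nonneg (hy0 ω)]
    have : 0 ≤ c * (y ω * √(y ω)) :=
      mul_nonneg hc.le (mul_nonneg (hy0 ω) (Real.sqrt_nonneg _))
    linarith
  have hhy : ∀ ω, h ω ≤ y ω + C * (EH ω + s / 2) ^ 2 := fun ω => by
    have : h ω - C * (EH ω + s / 2) ^ 2 ≤ y ω := le_max_left _ _
    linarith
  have hhyi : Integrable (fun ω => y ω + C * (EH ω + s / 2) ^ 2) P :=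
    hyi.add (hqi.const_mul C)
  have hhi : Integrable h P := by
    refine hhyi.mono' hh.aestronglyMeasurable ?_
    filter_upwards with ω
    rw [Real.norm_eq_abs, abs_of_nonneg (hh0 ω)]
    exact hhy ω
  set b := ∫ ω, y ω ∂P with hb
  have hb0 : 0 ≤ b := integral_nonneg hy0
  refine ⟨hhi, b, hb0, ?_, ?_⟩
  · refine (integral_mono hhi hhyi hhy).trans ?_
    rw [integral_add hyi (hqi.const_mul C), integral_const_mul]
    gcongr
  -- Jensen's inequality for `y ^ (3/2)`, through its tangent line at the mean `b`.
  · have hti : Integrable (fun ω => (1 + c * (3 / 2 * √b)) * y ω) P := hyi.const_mul _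
    have h1 : ∫ ω, ((1 + c * (3 / 2 * √b)) * y ω - c * (b * √b / 2)) ∂P ≤ ∫ ω, z ω ∂P := by
      refine integral_mono_ae (hti.sub (integrable_const _)) hzi ?_
      filter_upwards [hyz] with ω hω
      have h2 := mul_le_mul_of_nonneg_left (tangent_le_mul_sqrt (hy0 ω) hb0) hc.le
      linarith
    rw [integral_sub hti (integrable_const _), integral_const_mul, ← hb] at h1
    have h3 : ∫ ω, z ω ∂P ≤ ∫ ω, f ω ∂P + 2 * C * (s * √s) := by
      simp only [hz]
      have k1 : Integrable (fun ω => s * √s + (Eg ω + s / 2) ^ 2 / √s) P :=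
        (integrable_const _).add (hei.div_const _)
      rw [integral_add hf (k1.const_mul C), integral_const_mul,
        integral_add (integrable_const _) (hei.div_const _), integral_div]
      simp only [integral_const, probReal_univ, one_smul]
      have h4 : (∫ ω, (Eg ω + s / 2) ^ 2 ∂P) / √s ≤ s * √s := by
        rw [div_le_iff₀ (Real.sqrt_pos.2 hs), mul_assoc, Real.mul_self_sqrt hs.le]
        linarith
      have h5 := mul_le_mul_of_nonneg_left h4 hC.le
      linarith
    simp only [integral_const, probReal_univ, smul_eq_mul] at h1
    linarith

/-- Since `C s ^ 2 ≤ ε / 2 ≤ a' / 2` for `s = θ ε`, `b ≥ a' / 2` and the gain is at least `(c/4) a'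
^ (3/2)`. The noise `C s ^ 2 + 2 C s ^ (3/2)` is at most `3 C θ a' ^ (3/2)`, half of that gain. -/
theorem noisy_decrease {c C θ ε a a' b : ℝ} (hc : 0 < c) (hC : 0 < C) (hθ : 0 < θ) (hθ1 : θ ≤ 1)
    (hθC : 2 * C * θ ≤ 1) (hθc : 24 * C * θ ≤ c) (hε : 0 < ε) (hε1 : ε ≤ 1) (hεa : ε ≤ a')
    (h1 : a' ≤ b + C * (θ * ε) ^ 2) (h2 : b + c * (b * √b) ≤ a + 2 * C * (θ * ε * √(θ * ε))) :
    a' + c / 8 * (a' * √a') ≤ a := by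
  have ha' : 0 < a' := hε.trans_le hεa
  have hCs : C * (θ * ε) ^ 2 ≤ ε / 2 := by
    have : C * (θ * ε) ^ 2 = (C * θ) * (θ * ε) * ε := by ring
    rw [this]
    have k1 : θ * ε ≤ 1 := by nlinarith
    have k2 : C * θ * (θ * ε) ≤ 1 / 2 := by nlinarith [mul_pos hC hθ]
    nlinarith
  have hb : a' / 2 ≤ b := by linarith
  have hb0 : 0 < b := by linarith
  have hbb : a' * √a' / 4 ≤ b * √b := by
    have k1 : √a' / 2 ≤ √b := by
      refine Real.le_sqrt_of_sq_le ?_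
      rw [div_pow, Real.sq_sqrt ha'.le]
      linarith
    calc a' * √a' / 4 = a' / 2 * (√a' / 2) := by ring
      _ ≤ _ := by gcongr
  have hθε : 0 < θ * ε := by positivity
  have hs1 : θ * ε * √(θ * ε) ≤ θ * (a' * √a') := by
    have k1 : √(θ * ε) ≤ √a' := Real.sqrt_le_sqrt (by nlinarith)
    rw [← mul_assoc]
    gcongr
  have hs2 : (θ * ε) ^ 2 ≤ θ * ε * √(θ * ε) := by
    have k1 : θ * ε ≤ 1 := mul_le_one₀ hθ1 hε.le hε1
    have : θ * ε ≤ √(θ * ε) := Real.le_sqrt_of_sq_le (by nlinarith)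
    rw [sq]
    gcongr
  have hpos : 0 ≤ a' * √a' := by positivity
  nlinarith [mul_le_mul_of_nonneg_left hbb hc.le, mul_le_mul_of_nonneg_left hs1 hC.le,
    mul_le_mul_of_nonneg_left hs2 hC.le, mul_le_mul_of_nonneg_right hθc hpos]

/-! ### Runs of SHSODM -/

theorem isSelfAdjoint_batchMean {n N : ℕ} {M : Fin N → (Euc n →L[ℝ] Euc n)}
    (hM : ∀ i, IsSelfAdjoint (M i)) : IsSelfAdjoint (batchMean M) := by
  rw [ContinuousLinearMap.isSelfAdjoint_iff_isSymmetric]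
  intro v w
  have h : ∀ i, inner ℝ (M i v) w = inner ℝ v (M i w) := fun i =>
    ContinuousLinearMap.isSelfAdjoint_iff_isSymmetric.1 (hM i) v w
  simp [batchMean, real_inner_smul_left, inner_smul_right, sum_inner, inner_sum, h]

/-- The excess of `F` over its infimum and the accuracy `εw` of the gradient dominance. -/
noncomputable def excess {n : ℕ} (F : Euc n → ℝ) (εw : ℝ) (x : Euc n) : ℝ := max (F x - (⨅ y, F y) - εw) 0

section
variable {n : ℕ} {F : Euc n → ℝ} {X : Set (Euc n)} {Lg LH Cw εw : ℝ}

theorem measurable_excess (hF : Differentiable ℝ F) : Measurable (excess F εw) :=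
  ((hF.continuous.measurable.sub_const _).sub_const _).max measurable_const

/-- Gradient dominance is invoked only when the new excess is positive, where truncation at zero has
no effect. -/
theorem SHSODMStep.excess_recursion {p : SHSODMParams} {c C : ℝ} (hF : IsSmoothOn F X Lg LH)
    (hLH : 0 ≤ LH) (hX : Convex ℝ X) (hCw : 0 < Cw)
    (hdom : WeakGradientDominanceOn F X 1 Cw εw)
    (hrec : ∀ f h D e q : ℝ, 0 ≤ f → 0 ≤ D → 0 ≤ e → 0 ≤ q →
      (0 < h → h ≤ f - D ^ 3 + 2 * (e * √e) + q ^ 3 / 2 ∧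
        h ≤ Cw * (9 * LH + 17) * D ^ 2 + Cw * e + Cw * q ^ 2) →
      max (h - C * q ^ 2) 0 + c * (max (h - C * q ^ 2) 0 * √(max (h - C * q ^ 2) 0)) ≤
        f + C * (e * √e))
    {x x' g : Euc n} {H : Euc n →L[ℝ] Euc n} (hCe : p.Ce = 4 * LH + 8)
    (hls : 0 < p.εls) (hle : p.εls ≤ p.εeig) (hH : IsSelfAdjoint H)
    (hx : x ∈ X) (hx' : x' ∈ X) (h : SHSODMStep p g H x x') :
    max (excess F εw x' - C * (‖hessian F x - H‖ + p.εls) ^ 2) 0 +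
      c * (max (excess F εw x' - C * (‖hessian F x - H‖ + p.εls) ^ 2) 0 *
        √(max (excess F εw x' - C * (‖hessian F x - H‖ + p.εls) ^ 2) 0)) ≤
      excess F εw x +
        C * ((‖gradient F x - g‖ + p.εeig) * √(‖gradient F x - g‖ + p.εeig)) := by
  obtain ⟨D, hD, hA, hB⟩ := h.newton_step hF hLH hX hCe hls hle hH hx hx'
  have heig : 0 < p.εeig := hls.trans_le hle
  refine hrec _ _ D _ _ (le_max_right _ _) hD (by positivity) (by positivity) fun hpos => ?_
  have heq : excess F εw x' = F x' - (⨅ y, F y) - εw :=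
    max_eq_left ((lt_max_iff.1 hpos).resolve_right (lt_irrefl _)).le
  have hle : F x - (⨅ y, F y) - εw ≤ excess F εw x := le_max_left _ _
  have hdom' := hdom x' hx'
  rw [Real.rpow_one] at hdom'
  have hB' := mul_le_mul_of_nonneg_left hB hCw.le
  rw [heq]
  constructor <;> linarith

/-- The recursion is pathwise and each error enters through its own second moment, so the gradient
and Hessian batches may depend on each other. -/
theorem IsSHSODMRun.expected_step {p : SHSODMParams} {c C s σg σh : ℝ} {x₁ : Euc n}
    {Ξ : Type u} [MeasurableSpace Ξ] {D : Measure Ξ} {G : Euc n → Ξ → Euc n}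
    {Hs : Euc n → Ξ → (Euc n →L[ℝ] Euc n)} {Ω : Type v} [MeasurableSpace Ω] {P : Measure Ω}
    [IsProbabilityMeasure P] {ξg : ℕ → Fin p.ng → Ω → Ξ} {ξH : ℕ → Fin p.nH → Ω → Ξ}
    {x : ℕ → Ω → Euc n} (hrun : IsSHSODMRun P D G Hs p x₁ ξg ξH x)
    (horacle : IsStochasticOracleOn D F X 1 σg σh G Hs)
    (hF : IsSmoothOn F X Lg LH) (hLH : 0 ≤ LH) (hX : Convex ℝ X) (hCw : 0 < Cw)
    (hdom : WeakGradientDominanceOn F X 1 Cw εw) (hc : 0 < c) (hC : 0 < C) (hs : 0 < s)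
    (hrec : ∀ f h D e q : ℝ, 0 ≤ f → 0 ≤ D → 0 ≤ e → 0 ≤ q →
      (0 < h → h ≤ f - D ^ 3 + 2 * (e * √e) + q ^ 3 / 2 ∧
        h ≤ Cw * (9 * LH + 17) * D ^ 2 + Cw * e + Cw * q ^ 2) →
      max (h - C * q ^ 2) 0 + c * (max (h - C * q ^ 2) 0 * √(max (h - C * q ^ 2) 0)) ≤
        f + C * (e * √e))
    (hCe : p.Ce = 4 * LH + 8) (hls : p.εls = s / 2) (heig : p.εeig = s / 2)
    {k : ℕ} (hk : k ∈ Finset.Icc 1 p.K) (hxk : ∀ᵐ ω ∂P, x k ω ∈ X)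
    (hxk' : ∀ᵐ ω ∂P, x (k + 1) ω ∈ X)
    (hvg : ∀ z ∈ X, ∫⁻ ω, ENNReal.ofReal
      (‖gradient F z - batchMean (fun i => G z (ξg k i ω))‖ ^ 2) ∂P ≤ ENNReal.ofReal (s ^ 2 / 4))
    (hvH : ∀ z ∈ X, ∫⁻ ω, ENNReal.ofReal
      (‖hessian F z - batchMean (fun i => Hs z (ξH k i ω))‖ ^ 2) ∂P ≤ ENNReal.ofReal (s ^ 2 / 4))
    (hint : Integrable (fun ω => excess F εw (x k ω)) P) :
    Integrable (fun ω => excess F εw (x (k + 1) ω)) P ∧ ∃ b, 0 ≤ b ∧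
      ∫ ω, excess F εw (x (k + 1) ω) ∂P ≤ b + C * s ^ 2 ∧
      b + c * (b * √b) ≤ ∫ ω, excess F εw (x k ω) ∂P + 2 * C * (s * √s) := by
  obtain ⟨m1, i1, b1⟩ := integral_sq_batch_error_le (by positivity) horacle.measurable_grad
    hF.differentiable_gradient.continuous.measurable (hrun.measurable_iterate k)
    (fun i => (hrun.law_g k hk i).measurable) (hrun.fresh_g k hk) hxk hvg
  obtain ⟨m2, i2, b2⟩ := integral_sq_batch_error_le (by positivity) horacle.measurable_hess
    (measurable_fderiv ℝ (gradient F)) (hrun.measurable_iterate k)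
    (fun i => (hrun.law_H k hk i).measurable) (hrun.fresh_H k hk) hxk hvH
  refine expected_recursion hc hC hs hint
    ((measurable_excess hF.differentiable).comp (hrun.measurable_iterate (k + 1))) m1 m2
    (fun ω => le_max_right _ _) (fun ω => norm_nonneg _) i1 i2 b1 b2 ?_
  filter_upwards [hxk, hxk', hrun.step k hk] with ω h1 h2 h3
  have h := h3.excess_recursion hF hLH hX hCw hdom hrec hCe (by rw [hls]; positivity)
    (by rw [hls, heig]) (isSelfAdjoint_batchMean fun i => horacle.symmetric_hess _ _) h1 h2
  rwa [hls, heig] at h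

end

theorem mainTheorem5 (n : ℕ) (Lg LH σg σh Cweak Δ : ℝ)
    (hLg : 0 ≤ Lg) (hLH : 0 ≤ LH) (hσg : 0 ≤ σg) (hσh : 0 ≤ σh) (hCweak : 0 < Cweak) :
    ∃ C Ce : ℝ, 0 < C ∧ 0 < Ce ∧ ∀ ε : ℝ, 0 < ε → ε ≤ 1 →
      ∃ p : SHSODMParams, 1 ≤ p.K ∧ 1 ≤ p.ng ∧ 1 ≤ p.nH ∧
        0 < p.εls ∧ p.εls ≤ C * ε ∧ 0 < p.εeig ∧ p.εeig ≤ C * ε ∧ p.Ce = Ce ∧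
        ((p.K * (p.ng + p.nH) : ℕ) : ℝ) ≤ C * ε ^ (-(5 / 2) : ℝ) ∧
        ∀ (F : Euc n → ℝ) (X : Set (Euc n)) (εweak : ℝ) (x₁ : Euc n)
          (Ξ : Type u) (_ : MeasurableSpace Ξ) (D : Measure Ξ)
          (G : Euc n → Ξ → Euc n) (Hs : Euc n → Ξ → (Euc n →L[ℝ] Euc n))
          (Ω : Type v) (_ : MeasurableSpace Ω) (P : Measure Ω)
          (ξg : ℕ → Fin p.ng → Ω → Ξ) (ξH : ℕ → Fin p.nH → Ω → Ξ) (x : ℕ → Ω → Euc n),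
          0 ≤ εweak → IsProbabilityMeasure D → IsProbabilityMeasure P →
          BddBelow (Set.range F) → Convex ℝ X → IsSmoothOn F X Lg LH →
          WeakGradientDominanceOn F X 1 Cweak εweak →
          IsStochasticOracleOn D F X 1 σg σh G Hs →
          F x₁ - ⨅ y, F y ≤ Δ →
          IsSHSODMRun P D G Hs p x₁ ξg ξH x →
          (∀ k ∈ Finset.Icc 1 p.K, ∀ᵐ ω ∂P, x k ω ∈ X) →
          Integrable (fun ω => F (x p.K ω)) P ∧
          ∫ ω, (F (x p.K ω) - ⨅ y, F y) ∂P < ε + εweak := by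
  obtain ⟨c, C, hc, hC, hrec⟩ :=
    pos_part_recursion (c₁ := Cweak * (9 * LH + 17)) (by positivity) hCweak
  obtain ⟨Bg, hBg, hvarg⟩ := exists_batch_variance.{u, v} (Euc n)
  obtain ⟨BH, hBH, hvarH⟩ := exists_batch_variance.{u, v} (Euc n →L[ℝ] Euc n)
  obtain ⟨κ, hκ, hconv⟩ :=
    lt_of_cubic_decrease (c := c / 8) (M := max Δ 1) (by positivity) (by positivity)
  obtain ⟨θ, hθ, hθ1, hθC, hθc⟩ : ∃ θ : ℝ, 0 < θ ∧ θ ≤ 1 ∧ 2 * C * θ ≤ 1 ∧ 24 * C * θ ≤ c := by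
    refine ⟨min 1 (min (1 / (2 * C)) (c / (24 * C))), by positivity, min_le_left _ _, ?_, ?_⟩
    · rw [mul_comm, ← le_div_iff₀ (by positivity)]
      exact (min_le_right _ _).trans (min_le_left _ _)
    · rw [mul_comm, ← le_div_iff₀ (by positivity)]
      exact (min_le_right _ _).trans (min_le_right _ _)
  refine ⟨(κ + 3) * (4 * Bg * σg ^ 2 / θ ^ 2 + 4 * BH * σh ^ 2 / θ ^ 2 + 4) + 1, 4 * LH + 8,
    by positivity, by positivity, ?_⟩
  intro ε hε hε1
  have hs : 0 < θ * ε := by positivity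
  have htol : θ * ε / 2 ≤
      ((κ + 3) * (4 * Bg * σg ^ 2 / θ ^ 2 + 4 * BH * σh ^ 2 / θ ^ 2 + 4) + 1) * ε := by
    have h1 : 0 ≤ (κ + 3) * (4 * Bg * σg ^ 2 / θ ^ 2 + 4 * BH * σh ^ 2 / θ ^ 2 + 4) := by
      positivity
    nlinarith
  -- The batch sizes make both mean square errors at most `(θ ε) ^ 2 / 4`. The `+ 2` in `K` leaves
  -- `⌈κ / √ε⌉₊ + 1` steps from `x 1` to `x K`, strictly more than `κ / √ε`.
  obtain ⟨p, hK, hng', hnH', hls, heig, hpCe⟩ : ∃ p : SHSODMParams, p.K = ⌈κ / √ε⌉₊ + 2 ∧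
      p.ng = ⌈4 * (Bg * σg ^ 2) / (θ * ε) ^ 2⌉₊ + 1 ∧
      p.nH = ⌈4 * (BH * σh ^ 2) / (θ * ε) ^ 2⌉₊ + 1 ∧ p.εls = θ * ε / 2 ∧
      p.εeig = θ * ε / 2 ∧ p.Ce = 4 * LH + 8 := ⟨⟨_, _, _, _, _, _⟩, rfl, rfl, rfl, rfl, rfl, rfl⟩
  have hng : 0 < p.ng := hng' ▸ Nat.succ_pos _
  have hnH : 0 < p.nH := hnH' ▸ Nat.succ_pos _
  refine ⟨p, by omega, hng, hnH, by rw [hls]; positivity, by rwa [hls],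
    by rw [heig]; positivity, by rwa [heig], hpCe, ?_, ?_⟩
  · have hsq : 0 < √ε := Real.sqrt_pos.2 hε
    have hsq1 : √ε ≤ 1 := Real.sqrt_le_one.2 hε1
    have hpow : ε ^ (-(5 / 2) : ℝ) = 1 / √ε * (1 / ε ^ 2) := by
      rw [Real.rpow_neg hε.le, show (5 / 2 : ℝ) = 1 / 2 + 2 by norm_num, Real.rpow_add hε,
        ← Real.sqrt_eq_rpow, Real.rpow_two]
      field_simp
    have hKb : (p.K : ℝ) ≤ (κ + 3) * (1 / √ε) := by
      rw [hK]
      have h1 := (Nat.ceil_lt_add_one (by positivity : 0 ≤ κ / √ε)).le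
      have h2 : 1 ≤ 1 / √ε := by rw [le_div_iff₀ hsq]; linarith
      push_cast
      have h3 : (κ + 3) * (1 / √ε) = κ / √ε + 3 * (1 / √ε) := by ring
      linarith
    have hn : ∀ B : ℝ, 0 ≤ B →
        ((⌈B / (θ * ε) ^ 2⌉₊ + 1 : ℕ) : ℝ) ≤ (B / θ ^ 2 + 2) * (1 / ε ^ 2) := by
      intro B hB
      have h1 := (Nat.ceil_lt_add_one (by positivity : 0 ≤ B / (θ * ε) ^ 2)).le
      have h2 : 1 ≤ 1 / ε ^ 2 := by
        rw [le_div_iff₀ (by positivity)]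
        nlinarith
      push_cast
      have h3 : (B / θ ^ 2 + 2) * (1 / ε ^ 2) = B / (θ * ε) ^ 2 + 2 * (1 / ε ^ 2) := by
        field_simp
      linarith
    have hg := hn (4 * (Bg * σg ^ 2)) (by positivity)
    have hH := hn (4 * (BH * σh ^ 2)) (by positivity)
    rw [← hng', ← mul_assoc] at hg
    rw [← hnH', ← mul_assoc] at hH
    rw [hpow, Nat.cast_mul, Nat.cast_add]
    calc _ ≤ (κ + 3) * (1 / √ε) * ((4 * Bg * σg ^ 2 / θ ^ 2 + 2) * (1 / ε ^ 2) +
          (4 * BH * σh ^ 2 / θ ^ 2 + 2) * (1 / ε ^ 2)) := by gcongr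
      _ = (κ + 3) * (4 * Bg * σg ^ 2 / θ ^ 2 + 4 * BH * σh ^ 2 / θ ^ 2 + 4) *
          (1 / √ε * (1 / ε ^ 2)) := by ring
      _ ≤ _ := by
        gcongr
        linarith
  intro F X εweak x₁ Ξ _ D G Hs Ω _ P ξg ξH x hεw _ _ hbdd hX hF hdom horacle hΔ hrun hmem
  have hsize : ∀ B : ℝ, 0 ≤ B →
      B / ((⌈4 * B / (θ * ε) ^ 2⌉₊ + 1 : ℕ) : ℝ) ≤ (θ * ε) ^ 2 / 4 := by
    intro B hB
    have h1 := Nat.le_ceil (4 * B / (θ * ε) ^ 2)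
    rw [div_le_iff₀ (by positivity)] at h1
    rw [div_le_iff₀ (by positivity)]
    push_cast
    nlinarith [sq_nonneg (θ * ε)]
  have hsg : Bg * σg ^ 2 / (p.ng : ℝ) ≤ (θ * ε) ^ 2 / 4 := by
    rw [hng']
    exact hsize _ (by positivity)
  have hsH : BH * σh ^ 2 / (p.nH : ℝ) ≤ (θ * ε) ^ 2 / 4 := by
    rw [hnH']
    exact hsize _ (by positivity)
  -- Iterates are known to lie in `X` only up to `x K`, so the update that produces `x (K + 1)` is
  -- excluded.
  have hstep : ∀ k, 1 ≤ k → k + 1 ≤ p.K → Integrable (fun ω => excess F εweak (x k ω)) P →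
      Integrable (fun ω => excess F εweak (x (k + 1) ω)) P ∧ ∃ b, 0 ≤ b ∧
      ∫ ω, excess F εweak (x (k + 1) ω) ∂P ≤ b + C * (θ * ε) ^ 2 ∧
      b + c * (b * √b) ≤
        ∫ ω, excess F εweak (x k ω) ∂P + 2 * C * (θ * ε * √(θ * ε)) := by
    intro k hk1 hk2 hint
    have hk : k ∈ Finset.Icc 1 p.K := Finset.mem_Icc.2 ⟨hk1, by omega⟩
    have o3 := horacle.integrable_var_hess
    have o4 := horacle.variance_hess
    simp only [mul_one, Real.rpow_two] at o3 o4
    refine hrun.expected_step horacle hF hLH hX hCweak hdom hc hC hs hrec hpCe hls heig hk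
      (hmem k hk) (hmem (k + 1) (Finset.mem_Icc.2 ⟨by omega, hk2⟩)) (fun z hz => ?_)
      (fun z hz => ?_) hint
    · exact (hvarg Ξ D Ω P p.ng (G z) _ σg (ξg k) hng
        (horacle.measurable_grad.comp measurable_prodMk_left) (horacle.integrable_grad z hz)
        (horacle.unbiased_grad z hz) (horacle.integrable_var_grad z hz)
        (horacle.variance_grad z hz) (hrun.law_g k hk) (hrun.indep_g k hk)).trans
        (ENNReal.ofReal_le_ofReal hsg)
    · exact (hvarH Ξ D Ω P p.nH (Hs z) _ σh (ξH k) hnH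
        (horacle.measurable_hess.comp measurable_prodMk_left) (horacle.integrable_hess z hz)
        (horacle.unbiased_hess z hz) (o3 z hz) (o4 z hz) (hrun.law_H k hk)
        (hrun.indep_H k hk)).trans (ENNReal.ofReal_le_ofReal hsH)
  have hinit : (fun ω => excess F εweak (x 1 ω)) =ᵐ[P] fun _ => excess F εweak x₁ := by
    filter_upwards [hrun.init] with ω hω
    rw [hω]
  have hint : ∀ k, 1 ≤ k → k ≤ p.K → Integrable (fun ω => excess F εweak (x k ω)) P := by
    intro k hk1
    induction k, hk1 using Nat.le_induction with
    | base => exact fun _ => (integrable_congr hinit).2 (integrable_const _)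
    | succ k hk1 ih => exact fun hk2 => (hstep k hk1 hk2 (ih (by omega))).1
  have hlast : ∫ ω, excess F εweak (x p.K ω) ∂P < ε := by
    have h := hconv ε (⌈κ / √ε⌉₊ + 1) (fun k => ∫ ω, excess F εweak (x (k + 1) ω) ∂P) hε ?_ ?_ ?_
    · rwa [hK]
    · simp only [zero_add]
      rw [integral_congr_ae hinit]
      simp only [integral_const, probReal_univ, one_smul]
      exact max_le ((by linarith : _ ≤ Δ).trans (le_max_left _ _))
        (zero_le_one.trans (le_max_right _ _))
    · intro k hk hεk
      obtain ⟨-, b, -, h1, h2⟩ := hstep (k + 1) (by omega) (by omega)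
        (hint (k + 1) (by omega) (by omega))
      exact noisy_decrease hc hC hθ hθ1 hθC hθc hε hε1 hεk h1 h2
    · have hsq : 0 < √ε := Real.sqrt_pos.2 hε
      have h1 := Nat.le_ceil (κ / √ε)
      rw [div_le_iff₀ hsq] at h1
      push_cast
      linarith
  have hKint := hint p.K (by omega) le_rfl
  have hFm : Measurable fun ω => F (x p.K ω) :=
    hF.differentiable.continuous.measurable.comp (hrun.measurable_iterate _)
  have hgap0 : ∀ ω, 0 ≤ F (x p.K ω) - ⨅ y, F y := fun ω => sub_nonneg.2 (ciInf_le hbdd _)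
  have hgap : ∀ ω, F (x p.K ω) - ⨅ y, F y ≤ excess F εweak (x p.K ω) + εweak := fun ω => by
    have : F (x p.K ω) - (⨅ y, F y) - εweak ≤ excess F εweak (x p.K ω) := le_max_left _ _
    linarith
  have hbi : Integrable (fun ω => excess F εweak (x p.K ω) + εweak) P :=
    hKint.add (integrable_const _)
  have hgi : Integrable (fun ω => F (x p.K ω) - ⨅ y, F y) P := by
    refine hbi.mono' (hFm.sub_const _).aestronglyMeasurable ?_
    filter_upwards with ω
    rw [Real.norm_eq_abs, abs_of_nonneg (hgap0 ω)]
    exact hgap ω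
  have hFi : Integrable (fun ω => F (x p.K ω) - (⨅ y, F y) + ⨅ y, F y) P :=
    hgi.add (integrable_const _)
  refine ⟨by simpa only [sub_add_cancel] using hFi, ?_⟩
  refine (integral_mono hgi hbi hgap).trans_lt ?_
  rw [integral_add hKint (integrable_const _)]
  simp only [integral_const, probReal_univ, one_smul]
  linarith
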